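/- Let $U\subseteq\mathbb R^2$ be open, let $f=f(t,u)$ be $C^\infty$ on $U$, let $a<b$, and let $u:[a,b]\to\mathbb R$ satisfy $u'(t)=f(t,u(t))$ on $[a,b]$, with graph contained in $U$. Given real coefficients $a_{21},a_{31},a_{32},b_1,b_2,b_3,c_2,c_3$ and real numbers $\varepsilon_2^2,\varepsilon_3^2$ of either sign (squares of shape parameters in $\mathbb R\cup i\mathbb R$), the three-stage methods are $v_{n+1}=v_n+h(b_1k_1+b_2k_2+b_3k_3)$, $k_1=f(t_n,v_n)$, $k_i=f(t_n+c_ih,\,Y_i)$ $(i=2,3)$, where, with $s_i=\sqrt{1+\varepsilon_i^2c_i^2h^2}$, $K_2=a_{21}k_1$ and $K_3=a_{31}k_1+a_{32}k_2$, $$\text{MQ-RBF: } Y_i=(v_n+hK_i)\,s_i,\qquad \text{IMQ-RBF: } Y_i=s_i\,hK_i+\frac{v_n}{s_i}.$$ The shape parameters may vary from step to step. The local truncation error is $\tau(t,h)=\frac{u(t+h)-u(t)}h-(b_1k_1+b_2k_2+b_3k_3)$, with the stages and the shape parameters evaluated at $t_n=t$, $v_n=u(t)$. We say that $\tau=O(h^p)$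 uniformly on $[a,b]$ if there are $C$ and $h_0>0$ with $|\tau(t,h)|\le Ch^p$ whenever $0<h<h_0$ and $a\le t<t+h\le b$; a method is fourth-order accurate if this holds with $p=4$. The third-order conditions are $$b_1+b_2+b_3=1,\quad a_{21}=c_2,\quad a_{31}+a_{32}=c_3,\quad b_2c_2+b_3c_3=\tfrac12,\quad b_2c_2^2+b_3c_3^2=\tfrac13,\quad a_{32}b_3c_2=\tfrac16,$$ and the shape condition is $(\ast)\ b_2c_2^2\varepsilon_2^2+b_3c_3^2\varepsilon_3^2=0$. (0) If the third-order conditions hold and $\varepsilon_2^2,\varepsilon_3^2$ are bounded functions of $t\in[a,b]$ satisfying $(\ast)$, then $\tau=O(h^3)$ uniformly on $[a,b]$ for both the MQ-RBF and the IMQ-RBF method. Consider the tableaux $(a_{21}=c_2,\ a_{31},\ a_{32},\ c_3;\ b_1,b_2,b_3)$: $$A=(\tfrac13,-\tfrac5{12},\tfrac54,\tfrac56;\tfrac1{10},\tfrac12,\tfrac25),\quad B=(1,\tfrac14,\tfrac14,\tfrac12;\tfrac16,\tfrac16,\tfrac23),\quad C=(\tfrac12,0,\tfrac34,\tfrac34;\tfrac29,\tfrac13,\tfrac49),\quad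 D=(\tfrac12,-1,2,1;\tfrac16,\tfrac23,\tfrac16).$$ In each of the cases below the tableau satisfies the third-order conditions, the shape parameters satisfy $(\ast)$, and, if the denominator of $\varepsilon_2^2$ is nonzero at $(t,u(t))$ for all $t\in[a,b]$, then the $h^3$ term of $\tau$ cancels: $\tau=O(h^4)$ uniformly on $[a,b]$, so that the method is fourth-order accurate with only three stages. Here $f$ and its partial derivatives are evaluated at $(t,v)$, with $v=u(t)$ in $\tau$. MQ-RBF: I. Tableau $A$, $\varepsilon_2^2=\dfrac{ff_tf_{uu}-3ff_u^3-ff_uf_{tu}-3f_tf_u^2+f_tf_{tu}-f_{tt}f_u}{vff_{uu}-2vf_u^2+vf_{tu}+ff_u}$, $\varepsilon_3^2=-\frac15\varepsilon_2^2$. II. Tableau $B$, $\varepsilon_2^2=\dfrac{ff_tf_{uu}+ff_u^3-ff_uf_{tu}+f_tf_u^2+f_tf_{tu}-f_{tt}f_u}{vff_{uu}+2vf_u^2+vf_{tu}+ff_u}$, $\varepsilon_3^2=-\varepsilon_2^2$. III. Tableau $C$, $\varepsilon_2^2=\dfrac{-\frac13f^3f_{uuu}-f^2f_{tuu}-4ff_u^3-ff_{ttu}-4f_tf_u^2-\frac13f_{ttt}}{vff_{uu}-4vf_u^2+vf_{tu}+ff_u}$,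 $\varepsilon_3^2=-\frac13\varepsilon_2^2$. IMQ-RBF: I. Tableau $D$, $\varepsilon_2^2=\dfrac{-f^2f_uf_{uu}-ff_tf_{uu}+ff_u^3-ff_uf_{tu}+f_tf_u^2-f_tf_{tu}}{vff_{uu}-vf_u^2+vf_{tu}-ff_u}$, $\varepsilon_3^2=-\varepsilon_2^2$. II. Tableau $A$, $\varepsilon_2^2=\dfrac{-ff_tf_{uu}+3ff_u^3+ff_uf_{tu}+3f_tf_u^2-f_tf_{tu}+f_{tt}f_u}{vff_{uu}-2vf_u^2+vf_{tu}-ff_u}$, $\varepsilon_3^2=-\frac15\varepsilon_2^2$. III. Tableau $B$, $\varepsilon_2^2=\dfrac{-ff_tf_{uu}-ff_u^3+ff_uf_{tu}-f_tf_u^2-f_tf_{tu}+f_{tt}f_u}{vff_{uu}+2vf_u^2+vf_{tu}-ff_u}$, $\varepsilon_3^2=-\varepsilon_2^2$. IV. Tableau $C$, $\varepsilon_2^2=\dfrac{\frac13f^3f_{uuu}+f^2f_{tuu}+4ff_u^3+ff_{ttu}+4f_tf_u^2+\frac13f_{ttt}}{vff_{uu}-4vf_u^2+vf_{tu}-ff_u}$,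 $\varepsilon_3^2=-\frac13\varepsilon_2^2$. -/

import Mathlib

open scoped ContDiff

noncomputable section

namespace RBFRK

/-- Partial derivative of `f(t,u)` in the first variable. -/
def pt (f : ℝ → ℝ → ℝ) : ℝ → ℝ → ℝ := fun t v => deriv (fun s => f s v) t

/-- Partial derivative of `f(t,u)` in the second variable. -/
def pu (f : ℝ → ℝ → ℝ) : ℝ → ℝ → ℝ := fun t v => deriv (fun w => f t w) v

/-- Coefficients of an explicit three-stage tableau. -/
structure Tableau where
  a21 : ℝ
  a31 : ℝ
  a32 : ℝ
  b1 : ℝ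
  b2 : ℝ
  b3 : ℝ
  c2 : ℝ
  c3 : ℝ

/-- The consistency, row-sum and third-order conditions. -/
structure Tableau.ThirdOrderConditions (A : Tableau) : Prop where
  sum_b : A.b1 + A.b2 + A.b3 = 1
  row2 : A.a21 = A.c2
  row3 : A.a31 + A.a32 = A.c3
  cond1 : A.b2 * A.c2 + A.b3 * A.c3 = 1 / 2
  cond2 : A.b2 * A.c2 ^ 2 + A.b3 * A.c3 ^ 2 = 1 / 3
  cond3 : A.a32 * A.b3 * A.c2 = 1 / 6

/-- The coupling of the two squared shape parameters,
`b₂c₂²ε₂² + b₃c₃²ε₃² = 0`.  Since a shape parameter is real or purely imaginary, its square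
`e = ε²` is an arbitrary real number, and only the squares enter the methods. -/
def Tableau.ShapeCondition (A : Tableau) (e2 e3 : ℝ) : Prop :=
  A.b2 * A.c2 ^ 2 * e2 + A.b3 * A.c3 ^ 2 * e3 = 0

/-- `b₁k₁ + b₂k₂ + b₃k₃` for the three-stage MQ-RBF method with squared shape parameters
`e2`, `e3` and step `h`, started at `(t, v)`. -/
def mqIncrement (A : Tableau) (f : ℝ → ℝ → ℝ) (e2 e3 h t v : ℝ) : ℝ :=
  let k1 := f t v
  let k2 := f (t + A.c2 * h) ((v + h * (A.a21 * k1)) * √(1 + e2 * A.c2 ^ 2 * h ^ 2))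
  let k3 := f (t + A.c3 * h)
    ((v + h * (A.a31 * k1 + A.a32 * k2)) * √(1 + e3 * A.c3 ^ 2 * h ^ 2))
  A.b1 * k1 + A.b2 * k2 + A.b3 * k3

/-- `b₁k₁ + b₂k₂ + b₃k₃` for the three-stage IMQ-RBF method. -/
def imqIncrement (A : Tableau) (f : ℝ → ℝ → ℝ) (e2 e3 h t v : ℝ) : ℝ :=
  let k1 := f t v
  let k2 := f (t + A.c2 * h)
    (√(1 + e2 * A.c2 ^ 2 * h ^ 2) * (h * (A.a21 * k1)) + v / √(1 + e2 * A.c2 ^ 2 * h ^ 2))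
  let k3 := f (t + A.c3 * h)
    (√(1 + e3 * A.c3 ^ 2 * h ^ 2) * (h * (A.a31 * k1 + A.a32 * k2))
      + v / √(1 + e3 * A.c3 ^ 2 * h ^ 2))
  A.b1 * k1 + A.b2 * k2 + A.b3 * k3

/-- Local truncation error `τ = (u(t+h) - u(t))/h - (b₁k₁ + b₂k₂ + b₃k₃)` of the MQ method along
the exact solution `u`; the squared shape parameters are functions of `(t, u(t))`. -/
def mqTruncation (A : Tableau) (f : ℝ → ℝ → ℝ) (e2 e3 : ℝ → ℝ → ℝ) (u : ℝ → ℝ) (t h : ℝ) : ℝ :=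
  (u (t + h) - u t) / h - mqIncrement A f (e2 t (u t)) (e3 t (u t)) h t (u t)

/-- Local truncation error of the IMQ method along the exact solution `u`. -/
def imqTruncation (A : Tableau) (f : ℝ → ℝ → ℝ) (e2 e3 : ℝ → ℝ → ℝ) (u : ℝ → ℝ) (t h : ℝ) : ℝ :=
  (u (t + h) - u t) / h - imqIncrement A f (e2 t (u t)) (e3 t (u t)) h t (u t)

/-- `τ(t,h) = O(h^p)` as `h → 0⁺`, uniformly over all steps `[t, t+h] ⊆ [a, b]`. -/
def OrderOn (a b : ℝ) (p : ℕ) (τ : ℝ → ℝ → ℝ) : Prop :=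
  ∃ C h₀ : ℝ, 0 < h₀ ∧ ∀ t h : ℝ, 0 < h → h < h₀ → a ≤ t → t + h ≤ b → |τ t h| ≤ C * h ^ p

/-- A tableau with the shape parameters `ε₂² = num / den` (expressions in `f`, its partial
derivatives and `v`, evaluated at `(t, v)`) and `ε₃² = ratio * ε₂²`. -/
structure Method where
  A : Tableau
  num : (ℝ → ℝ → ℝ) → ℝ → ℝ → ℝ
  den : (ℝ → ℝ → ℝ) → ℝ → ℝ → ℝ
  ratio : ℝ

def Method.eps2 (M : Method) (f : ℝ → ℝ → ℝ) (t v : ℝ) : ℝ := M.num f t v / M.den f t v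

def Method.eps3 (M : Method) (f : ℝ → ℝ → ℝ) (t v : ℝ) : ℝ := M.ratio * M.eps2 f t v

def tableauA : Tableau where
  a21 := 1 / 3
  a31 := -5 / 12
  a32 := 5 / 4
  b1 := 1 / 10
  b2 := 1 / 2
  b3 := 2 / 5
  c2 := 1 / 3
  c3 := 5 / 6

def tableauB : Tableau where
  a21 := 1
  a31 := 1 / 4
  a32 := 1 / 4
  b1 := 1 / 6
  b2 := 1 / 6
  b3 := 2 / 3
  c2 := 1
  c3 := 1 / 2

def tableauC : Tableau where
  a21 := 1 / 2
  a31 := 0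
  a32 := 3 / 4
  b1 := 2 / 9
  b2 := 1 / 3
  b3 := 4 / 9
  c2 := 1 / 2
  c3 := 3 / 4

def tableauD : Tableau where
  a21 := 1 / 2
  a31 := -1
  a32 := 2
  b1 := 1 / 6
  b2 := 2 / 3
  b3 := 1 / 6
  c2 := 1 / 2
  c3 := 1

def mqI : Method where
  A := tableauA
  num f t v :=
    f t v * pt f t v * pu (pu f) t v - 3 * f t v * pu f t v ^ 3
      - f t v * pu f t v * pt (pu f) t v - 3 * pt f t v * pu f t v ^ 2
      + pt f t v * pt (pu f) t v - pt (pt f) t v * pu f t v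
  den f t v :=
    v * f t v * pu (pu f) t v - 2 * v * pu f t v ^ 2 + v * pt (pu f) t v + f t v * pu f t v
  ratio := -1 / 5

def mqII : Method where
  A := tableauB
  num f t v :=
    f t v * pt f t v * pu (pu f) t v + f t v * pu f t v ^ 3
      - f t v * pu f t v * pt (pu f) t v + pt f t v * pu f t v ^ 2
      + pt f t v * pt (pu f) t v - pt (pt f) t v * pu f t v
  den f t v :=
    v * f t v * pu (pu f) t v + 2 * v * pu f t v ^ 2 + v * pt (pu f) t v + f t v * pu f t v
  ratio := -1

def mqIII : Method where
  A := tableauC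
  num f t v :=
    -(1 / 3) * f t v ^ 3 * pu (pu (pu f)) t v - f t v ^ 2 * pt (pu (pu f)) t v
      - 4 * f t v * pu f t v ^ 3 - f t v * pt (pt (pu f)) t v
      - 4 * pt f t v * pu f t v ^ 2 - 1 / 3 * pt (pt (pt f)) t v
  den f t v :=
    v * f t v * pu (pu f) t v - 4 * v * pu f t v ^ 2 + v * pt (pu f) t v + f t v * pu f t v
  ratio := -1 / 3

def imqI : Method where
  A := tableauD
  num f t v :=
    -(f t v ^ 2 * pu f t v * pu (pu f) t v) - f t v * pt f t v * pu (pu f) t v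
      + f t v * pu f t v ^ 3 - f t v * pu f t v * pt (pu f) t v
      + pt f t v * pu f t v ^ 2 - pt f t v * pt (pu f) t v
  den f t v :=
    v * f t v * pu (pu f) t v - v * pu f t v ^ 2 + v * pt (pu f) t v - f t v * pu f t v
  ratio := -1

def imqII : Method where
  A := tableauA
  num f t v :=
    -(f t v * pt f t v * pu (pu f) t v) + 3 * f t v * pu f t v ^ 3
      + f t v * pu f t v * pt (pu f) t v + 3 * pt f t v * pu f t v ^ 2
      - pt f t v * pt (pu f) t v + pt (pt f) t v * pu f t v
  den f t v :=
    v * f t v * pu (pu f) t v - 2 * v * pu f t v ^ 2 + v * pt (pu f) t v - f t v * pu f t v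
  ratio := -1 / 5

def imqIII : Method where
  A := tableauB
  num f t v :=
    -(f t v * pt f t v * pu (pu f) t v) - f t v * pu f t v ^ 3
      + f t v * pu f t v * pt (pu f) t v - pt f t v * pu f t v ^ 2
      - pt f t v * pt (pu f) t v + pt (pt f) t v * pu f t v
  den f t v :=
    v * f t v * pu (pu f) t v + 2 * v * pu f t v ^ 2 + v * pt (pu f) t v - f t v * pu f t v
  ratio := -1

def imqIV : Method where
  A := tableauC
  num f t v :=
    1 / 3 * f t v ^ 3 * pu (pu (pu f)) t v + f t v ^ 2 * pt (pu (pu f)) t v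
      + 4 * f t v * pu f t v ^ 3 + f t v * pt (pt (pu f)) t v
      + 4 * pt f t v * pu f t v ^ 2 + 1 / 3 * pt (pt (pt f)) t v
  den f t v :=
    v * f t v * pu (pu f) t v - 4 * v * pu f t v ^ 2 + v * pt (pu f) t v - f t v * pu f t v
  ratio := -1 / 3

/-- On `[a, b]` the MQ method `M` has a truncation error `O(h⁴)` along the solution `u`, whenever
its shape parameters are defined (nonvanishing denominator) along `u`; moreover its tableau
satisfies the third-order conditions and its shape parameters are coupled as required. -/
def Method.FourthOrderMQ (M : Method) (f : ℝ → ℝ → ℝ) (a b : ℝ) (u : ℝ → ℝ) : Prop :=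
  M.A.ThirdOrderConditions ∧
  (∀ t v : ℝ, M.A.ShapeCondition (M.eps2 f t v) (M.eps3 f t v)) ∧
  ((∀ t ∈ Set.Icc a b, M.den f t (u t) ≠ 0) →
    OrderOn a b 4 (mqTruncation M.A f (M.eps2 f) (M.eps3 f) u))

/-- The same for the IMQ method. -/
def Method.FourthOrderIMQ (M : Method) (f : ℝ → ℝ → ℝ) (a b : ℝ) (u : ℝ → ℝ) : Prop :=
  M.A.ThirdOrderConditions ∧
  (∀ t v : ℝ, M.A.ShapeCondition (M.eps2 f t v) (M.eps3 f t v)) ∧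
  ((∀ t ∈ Set.Icc a b, M.den f t (u t) ≠ 0) →
    OrderOn a b 4 (imqTruncation M.A f (M.eps2 f) (M.eps3 f) u))

end RBFRK

end

/-! Along the solution, expand both parts of the truncation error in powers of `h` up to `O(h⁴)`,
uniformly in the base point. The difference quotient has coefficients `f`, `solD2 f / 2`, `solD3 f /
6`, `solD4 f / 24`. In a stage the radical is `1 + c²ε²h²/2 + O(h⁴)`, so the shape parameter adds
`±c²ε²v/2` to the `h²` coefficient of the argument (plus for MQ, minus for IMQ) and a multiple of
`ε²` to its `h³` coefficient. The third-order conditions cancel the classical terms through `h²`,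
and the shape condition cancels the new `h²` term; this gives order three
(`hasExpansion_truncation`).

The remaining coefficient `defect` is affine in the squared shape parameters. Without them it cannot
vanish identically: three stages never produce the term `f_u²(f_t + f f_u)/24` of the solution. With
`ε₃²` a fixed multiple of `ε₂²`, it equals a constant times `ε₂² * den - num`, so the prescribed
quotient annihilates it.

Uniformity comes from compactness of the graph: partial derivatives are bounded on it, a closed
thickening stays inside `U` (`exists_taylor_bound`), and a denominator without zeros on it gives
bounded shape parameters. `HasExpansion` records such expansions with bounded coefficients; it is
closed under sums, products and substitution into a smooth function (`HasExpansion.comp`). -/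

noncomputable section

namespace RBFRK

open Set Filter Topology Asymptotics

/-! ### Taylor's inequality in one variable -/

/-- Taylor's inequality for a chain of successive derivatives `g 0, g 1, …, g n` on `[0, H]`. -/
theorem abs_sub_taylor_le {H C : ℝ} (n : ℕ) (g : ℕ → ℝ → ℝ)
    (hg : ∀ k < n, ∀ x ∈ Icc 0 H, HasDerivWithinAt (g k) (g (k + 1) x) (Icc 0 H) x)
    (hC : ∀ x ∈ Icc 0 H, |g n x| ≤ C) :
    ∀ x ∈ Icc 0 H, |g 0 x - ∑ k ∈ Finset.range n, g k 0 * x ^ k / (k.factorial : ℝ)|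
      ≤ C * x ^ n / (n.factorial : ℝ) := by
  induction n generalizing g with
  | zero => simpa using hC
  | succ n ih =>
    -- The shifted chain bounds the derivative of the remainder.
    have key := ih (fun k => g (k + 1)) (fun k hk => hg (k + 1) (by omega)) hC
    have hS : ∀ x, HasDerivAt
        (fun x => ∑ k ∈ Finset.range (n + 1), g k 0 * x ^ k / (k.factorial : ℝ))
        (∑ k ∈ Finset.range n, g (k + 1) 0 * x ^ k / (k.factorial : ℝ)) x := by
      intro x
      have h1 : HasDerivAt
          (fun x => ∑ k ∈ Finset.range (n + 1), g k 0 * x ^ k / (k.factorial : ℝ))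
          (∑ k ∈ Finset.range (n + 1), g k 0 * (k * x ^ (k - 1)) / (k.factorial : ℝ)) x :=
        HasDerivAt.fun_sum fun k _ => ((hasDerivAt_pow k x).const_mul _).div_const _
      convert h1 using 1
      rw [Finset.sum_range_succ']
      simp only [Nat.cast_zero, zero_mul, mul_zero, zero_div, add_zero, Nat.add_sub_cancel]
      refine Finset.sum_congr rfl fun k _ => ?_
      rw [Nat.factorial_succ]
      have : (k.factorial : ℝ) ≠ 0 := by positivity
      have : ((k : ℝ) + 1) ≠ 0 := by positivity
      push_cast
      field_simp
    have hB : ∀ x, HasDerivAt (fun x => C * x ^ (n + 1) / ((n + 1).factorial : ℝ))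
        (C * x ^ n / (n.factorial : ℝ)) x := by
      intro x
      have h1 := ((hasDerivAt_pow (n + 1) x).const_mul C).div_const ((n + 1).factorial : ℝ)
      refine h1.congr_deriv ?_
      rw [Nat.factorial_succ]
      have : (n.factorial : ℝ) ≠ 0 := by positivity
      have : ((n : ℝ) + 1) ≠ 0 := by positivity
      push_cast
      field_simp
    have hd : ∀ x ∈ Icc 0 H, HasDerivWithinAt
        (fun x => g 0 x - ∑ k ∈ Finset.range (n + 1), g k 0 * x ^ k / (k.factorial : ℝ))
        (g 1 x - ∑ k ∈ Finset.range n, g (k + 1) 0 * x ^ k / (k.factorial : ℝ)) (Icc 0 H) x :=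
      fun x hx => (hg 0 (by omega) x hx).sub (hS x).hasDerivWithinAt
    -- Mean value inequality: the remainder and its majorant both vanish at `0`, and the derivatives
    -- compare by `key`.
    refine fun x hx => image_norm_le_of_norm_deriv_right_le_deriv_boundary
      (fun y hy => (hd y hy).continuousWithinAt)
      (fun y hy => (hd y (Ico_subset_Icc_self hy)).mono_of_mem_nhdsWithin
        (Icc_mem_nhdsGE_of_mem hy)) ?_ hB
      (fun y hy => key y (Ico_subset_Icc_self hy)) hx
    rw [Finset.sum_range_succ']
    simp

/-! ### Partial derivatives and Taylor's inequality in the plane -/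

/-- `F(t, u)` is smooth on the set `U` of the plane. -/
def SmoothOn (U : Set (ℝ × ℝ)) (F : ℝ → ℝ → ℝ) : Prop :=
  ContDiffOn ℝ ∞ (fun p : ℝ × ℝ => F p.1 p.2) U

section Partial

variable {U : Set (ℝ × ℝ)} {F : ℝ → ℝ → ℝ}

theorem SmoothOn.contDiffAt (hU : IsOpen U) (hF : SmoothOn U F) {p : ℝ × ℝ} (hp : p ∈ U) :
    ContDiffAt ℝ ∞ (fun p : ℝ × ℝ => F p.1 p.2) p :=
  ContDiffOn.contDiffAt hF (hU.mem_nhds hp)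

theorem SmoothOn.hasFDerivAt (hU : IsOpen U) (hF : SmoothOn U F) {p : ℝ × ℝ} (hp : p ∈ U) :
    HasFDerivAt (fun p : ℝ × ℝ => F p.1 p.2) (fderiv ℝ (fun p : ℝ × ℝ => F p.1 p.2) p) p :=
  ((hF.contDiffAt hU hp).differentiableAt (by simp)).hasFDerivAt

theorem pt_eq_fderiv (hU : IsOpen U) (hF : SmoothOn U F) {p : ℝ × ℝ} (hp : p ∈ U) :
    pt F p.1 p.2 = fderiv ℝ (fun p : ℝ × ℝ => F p.1 p.2) p (1, 0) := by
  have h2 : HasDerivAt (fun s : ℝ => (s, p.2)) ((1 : ℝ), (0 : ℝ)) p.1 :=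
    (hasDerivAt_id p.1).prodMk (hasDerivAt_const _ _)
  exact ((hF.hasFDerivAt hU hp).comp_hasDerivAt p.1 h2).deriv

theorem pu_eq_fderiv (hU : IsOpen U) (hF : SmoothOn U F) {p : ℝ × ℝ} (hp : p ∈ U) :
    pu F p.1 p.2 = fderiv ℝ (fun p : ℝ × ℝ => F p.1 p.2) p (0, 1) := by
  have h2 : HasDerivAt (fun s : ℝ => (p.1, s)) ((0 : ℝ), (1 : ℝ)) p.2 :=
    (hasDerivAt_const _ _).prodMk (hasDerivAt_id p.2)
  exact ((hF.hasFDerivAt hU hp).comp_hasDerivAt p.2 h2).deriv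

theorem SmoothOn.fderiv_apply (hU : IsOpen U) (hF : SmoothOn U F) (w : ℝ × ℝ) :
    ContDiffOn ℝ ∞ (fun p => fderiv ℝ (fun p : ℝ × ℝ => F p.1 p.2) p w) U :=
  (ContDiffOn.fderiv_of_isOpen hF hU (by simp)).clm_apply contDiffOn_const

theorem SmoothOn.pt (hU : IsOpen U) (hF : SmoothOn U F) : SmoothOn U (pt F) :=
  (hF.fderiv_apply hU (1, 0)).congr fun _ hp => pt_eq_fderiv hU hF hp

theorem SmoothOn.pu (hU : IsOpen U) (hF : SmoothOn U F) : SmoothOn U (pu F) :=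
  (hF.fderiv_apply hU (0, 1)).congr fun _ hp => pu_eq_fderiv hU hF hp

/-- Chain rule along a curve in the plane. -/
theorem SmoothOn.hasDerivWithinAt_comp (hU : IsOpen U) (hF : SmoothOn U F) {x y : ℝ → ℝ}
    {x' y' s : ℝ} {S : Set ℝ} (hx : HasDerivWithinAt x x' S s) (hy : HasDerivWithinAt y y' S s)
    (hs : (x s, y s) ∈ U) :
    HasDerivWithinAt (fun r => F (x r) (y r))
      (x' * RBFRK.pt F (x s) (y s) + y' * RBFRK.pu F (x s) (y s)) S s := by
  have h := (hF.hasFDerivAt hU hs).comp_hasDerivWithinAt s (hx.prodMk hy)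
  refine h.congr_deriv ?_
  have e : ((x', y') : ℝ × ℝ) = x' • ((1 : ℝ), (0 : ℝ)) + y' • ((0 : ℝ), (1 : ℝ)) := by simp
  rw [e, map_add, map_smul, map_smul, ← pt_eq_fderiv hU hF hs, ← pu_eq_fderiv hU hF hs]
  simp

/-- Openness of `U` makes the equality hold near `p`. This allows the symmetry of mixed partials,
known only on `U`, to be differentiated again. -/
theorem pt_congr (hU : IsOpen U) {G : ℝ → ℝ → ℝ}
    (h : ∀ p ∈ U, F p.1 p.2 = G p.1 p.2) {p : ℝ × ℝ} (hp : p ∈ U) :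
    pt F p.1 p.2 = pt G p.1 p.2 := by
  refine Filter.EventuallyEq.deriv_eq ?_
  have hc : ContinuousAt (fun s : ℝ => (s, p.2)) p.1 := by fun_prop
  filter_upwards [hc.preimage_mem_nhds (hU.mem_nhds hp)] with s hs using h _ hs

/-- Mixed partial derivatives commute. -/
theorem pu_pt (hU : IsOpen U) (hF : SmoothOn U F) {p : ℝ × ℝ} (hp : p ∈ U) :
    pu (pt F) p.1 p.2 = pt (pu F) p.1 p.2 := by
  have hD : DifferentiableAt ℝ (fderiv ℝ (fun p : ℝ × ℝ => F p.1 p.2)) p :=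
    ((ContDiffOn.fderiv_of_isOpen hF hU (m := ∞) (by simp)).contDiffAt
      (hU.mem_nhds hp)).differentiableAt (by simp)
  -- Either mixed partial is the second Fréchet derivative at two basis vectors, so its symmetry
  -- finishes the proof.
  have key : ∀ G : ℝ → ℝ → ℝ, ∀ w z : ℝ × ℝ,
      (∀ q ∈ U, G q.1 q.2 = fderiv ℝ (fun p : ℝ × ℝ => F p.1 p.2) q w) →
      fderiv ℝ (fun p : ℝ × ℝ => G p.1 p.2) p z
        = fderiv ℝ (fderiv ℝ (fun p : ℝ × ℝ => F p.1 p.2)) p z w := by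
    intro G w z hG
    have : (fun p : ℝ × ℝ => G p.1 p.2) =ᶠ[𝓝 p]
        fun q => fderiv ℝ (fun p : ℝ × ℝ => F p.1 p.2) q w := by
      filter_upwards [hU.mem_nhds hp] with q hq using hG q hq
    rw [this.fderiv_eq, fderiv_clm_apply hD (differentiableAt_const _)]
    simp
  rw [pu_eq_fderiv hU (hF.pt hU) hp, pt_eq_fderiv hU (hF.pu hU) hp,
    key _ (1, 0) (0, 1) fun q hq => pt_eq_fderiv hU hF hq,
    key _ (0, 1) (1, 0) fun q hq => pu_eq_fderiv hU hF hq]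
  exact ((hF.contDiffAt hU hp).isSymmSndFDerivAt (by
    rw [minSmoothness_of_isRCLikeNormedField]
    exact WithTop.coe_le_coe.2 (le_top : (2 : ℕ∞) ≤ ⊤))) _ _

/-- Together with `pu_pt`, this moves `pu` innermost, a normal form in which `ring` can compare
partials. -/
theorem pu_pt_pt (hU : IsOpen U) (hF : SmoothOn U F) {p : ℝ × ℝ} (hp : p ∈ U) :
    pu (pt (pt F)) p.1 p.2 = pt (pt (pu F)) p.1 p.2 :=
  (pu_pt hU (hF.pt hU) hp).trans (pt_congr hU (fun _ hq => pu_pt hU hF hq) hp)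

theorem pu_congr (hU : IsOpen U) {G : ℝ → ℝ → ℝ}
    (h : ∀ p ∈ U, F p.1 p.2 = G p.1 p.2) {p : ℝ × ℝ} (hp : p ∈ U) :
    pu F p.1 p.2 = pu G p.1 p.2 := by
  refine Filter.EventuallyEq.deriv_eq ?_
  have hc : ContinuousAt (fun s : ℝ => (p.1, s)) p.2 := by fun_prop
  filter_upwards [hc.preimage_mem_nhds (hU.mem_nhds hp)] with s hs using h _ hs

theorem SmoothOn.exists_bound (hF : SmoothOn U F) {K : Set (ℝ × ℝ)} (hK : IsCompact K)
    (hKU : K ⊆ U) : ∃ C, 0 ≤ C ∧ ∀ p ∈ K, |F p.1 p.2| ≤ C := by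
  obtain ⟨C, hC⟩ := hK.exists_bound_of_continuousOn (ContDiffOn.continuousOn hF |>.mono hKU)
  exact ⟨max C 0, le_max_right _ _, fun p hp => (hC p hp).trans (le_max_left _ _)⟩

/-- The `k`-th derivative of `F` in the direction `(x, y)`. -/
def dirDeriv (x y : ℝ) : ℕ → (ℝ → ℝ → ℝ) → ℝ → ℝ → ℝ
  | 0, F => F
  | k + 1, F => fun t v => x * dirDeriv x y k (pt F) t v + y * dirDeriv x y k (pu F) t v

/-- Restricted to a line, the directional derivatives form the chain required by
`abs_sub_taylor_le`. -/
theorem hasDerivAt_dirDeriv (hU : IsOpen U) (hF : SmoothOn U F) (x y t v : ℝ) (k : ℕ) {s : ℝ}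
    (hs : (t + s * x, v + s * y) ∈ U) :
    HasDerivAt (fun r => dirDeriv x y k F (t + r * x) (v + r * y))
      (dirDeriv x y (k + 1) F (t + s * x) (v + s * y)) s := by
  induction k generalizing F with
  | zero =>
    rw [← hasDerivWithinAt_univ]
    have hx : ∀ t x : ℝ, HasDerivWithinAt (fun r : ℝ => t + r * x) x univ s := fun t x => by
      simpa using (((hasDerivAt_id s).mul_const x).const_add t).hasDerivWithinAt (s := univ)
    exact hF.hasDerivWithinAt_comp hU (hx t x) (hx v y) hs
  | succ k ih => exact ((ih (hF.pt hU)).const_mul x).add ((ih (hF.pu hU)).const_mul y)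

/-- The directional derivative is homogeneous of degree `k` in `(x, y)`, with partial derivatives as
coefficients; hence one constant serves all directions. -/
theorem exists_dirDeriv_bound (hU : IsOpen U) (hF : SmoothOn U F) {K : Set (ℝ × ℝ)}
    (hK : IsCompact K) (hKU : K ⊆ U) (k : ℕ) :
    ∃ C, 0 ≤ C ∧ ∀ x y, ∀ p ∈ K, |dirDeriv x y k F p.1 p.2| ≤ C * (|x| + |y|) ^ k := by
  induction k generalizing F with
  | zero =>
    obtain ⟨C, h0, hC⟩ := hF.exists_bound hK hKU
    exact ⟨C, h0, fun x y p hp => by simpa [dirDeriv] using hC p hp⟩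
  | succ k ih =>
    obtain ⟨C, hC0, hC⟩ := ih (hF.pt hU)
    obtain ⟨D, hD0, hD⟩ := ih (hF.pu hU)
    refine ⟨C + D, by positivity, fun x y p hp => ?_⟩
    have h1 := mul_le_mul_of_nonneg_left (hC x y p hp) (abs_nonneg x)
    have h2 := mul_le_mul_of_nonneg_left (hD x y p hp) (abs_nonneg y)
    have hE : 0 ≤ (|x| + |y|) ^ k := by positivity
    calc |dirDeriv x y (k + 1) F p.1 p.2|
        ≤ |x| * |dirDeriv x y k (pt F) p.1 p.2| + |y| * |dirDeriv x y k (pu F) p.1 p.2| := by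
          rw [← abs_mul, ← abs_mul]; exact abs_add_le _ _
      _ ≤ |x| * (C * (|x| + |y|) ^ k) + |y| * (D * (|x| + |y|) ^ k) := add_le_add h1 h2
      _ ≤ (C + D) * (|x| + |y|) ^ (k + 1) := by
          have e : (C + D) * (|x| + |y|) ^ (k + 1)
            = |x| * (C * (|x| + |y|) ^ k) + |y| * (D * (|x| + |y|) ^ k)
              + (|x| * (D * (|x| + |y|) ^ k) + |y| * (C * (|x| + |y|) ^ k)) := by ring
          rw [e]
          have : 0 ≤ |x| * (D * (|x| + |y|) ^ k) + |y| * (C * (|x| + |y|) ^ k) := by positivity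
          linarith

/-- Taylor's inequality in the plane, uniform over base points in a compact set. -/
theorem exists_taylor_bound (hU : IsOpen U) (hF : SmoothOn U F) {K : Set (ℝ × ℝ)}
    (hK : IsCompact K) (hKU : K ⊆ U) (n : ℕ) :
    ∃ C δ, 0 < δ ∧ ∀ t v x y, (t, v) ∈ K → |x| ≤ δ → |y| ≤ δ →
      |F (t + x) (v + y) - ∑ k ∈ Finset.range n, dirDeriv x y k F t v / (k.factorial : ℝ)|
        ≤ C * (|x| + |y|) ^ n := by
  -- The thickening contains the whole segment from a base point in `K` to the displaced point.
  obtain ⟨δ, hδ, hsub⟩ := hK.exists_cthickening_subset_open hU hKU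
  obtain ⟨C, hC0, hC⟩ := exists_dirDeriv_bound hU hF hK.cthickening hsub n
  refine ⟨C, δ, hδ, fun t v x y hp hx hy => ?_⟩
  have hmem : ∀ s ∈ Icc (0 : ℝ) 1, (t + s * x, v + s * y) ∈ Metric.cthickening δ K := by
    intro s hs
    have hle : ∀ z : ℝ, |z| ≤ δ → |s * z| ≤ δ := fun z hz => by
      rw [abs_mul, abs_of_nonneg hs.1]
      exact (mul_le_of_le_one_left (abs_nonneg z) hs.2).trans hz
    refine Metric.mem_cthickening_of_dist_le _ (t, v) δ K hp ?_
    rw [Prod.dist_eq, Real.dist_eq, Real.dist_eq]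
    simpa only [add_sub_cancel_left] using max_le (hle x hx) (hle y hy)
  have h := abs_sub_taylor_le (H := 1) (C := C * (|x| + |y|) ^ n) n
    (fun k r => dirDeriv x y k F (t + r * x) (v + r * y))
    (fun k _ s hs => (hasDerivAt_dirDeriv hU hF x y t v k (hsub (hmem s hs))).hasDerivWithinAt)
    (fun s hs => hC x y _ (hmem s hs)) 1 (by simp)
  have hn : (1 : ℝ) ≤ (n.factorial : ℝ) := by exact_mod_cast n.factorial_pos
  simp only [one_mul, zero_mul, add_zero, one_pow, mul_one] at h
  exact h.trans (div_le_self (by positivity) hn)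

end Partial

/-! ### Calculus of expansions up to `O(h⁴)` -/

/-- `g = a₀ + a₁ h + a₂ h² + a₃ h³ + O(h⁴)` along `l`, with bounded coefficients. -/
structure HasExpansion {α : Type*} (l : Filter α) (h g a₀ a₁ a₂ a₃ : α → ℝ) : Prop where
  bdd₀ : a₀ =O[l] (fun _ => (1 : ℝ))
  bdd₁ : a₁ =O[l] (fun _ => (1 : ℝ))
  bdd₂ : a₂ =O[l] (fun _ => (1 : ℝ))
  bdd₃ : a₃ =O[l] (fun _ => (1 : ℝ))
  rem : (fun p => g p - (a₀ p + a₁ p * h p + a₂ p * h p ^ 2 + a₃ p * h p ^ 3)) =O[l]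
    fun p => h p ^ 4

section Expansion

variable {α : Type*} {l : Filter α} {h g g' a₀ a₁ a₂ a₃ b₀ b₁ b₂ b₃ : α → ℝ}

theorem bdd_mul {f g : α → ℝ} (hf : f =O[l] (fun _ => (1 : ℝ))) (hg : g =O[l] (fun _ => (1 : ℝ))) :
    (fun p => f p * g p) =O[l] (fun _ => (1 : ℝ)) := by simpa using hf.mul hg

theorem bdd_const (c : ℝ) : (fun _ : α => c) =O[l] (fun _ => (1 : ℝ)) :=
  isBigO_const_const c one_ne_zero l

theorem pow_isBigO (hh : h =O[l] (fun _ => (1 : ℝ))) (m n : ℕ) :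
    (fun p => h p ^ (m + n)) =O[l] fun p => h p ^ m := by
  have := (isBigO_refl (fun p => h p ^ m) l).mul (hh.pow n)
  simpa [pow_add] using this

theorem HasExpansion.congr (H : HasExpansion l h g a₀ a₁ a₂ a₃)
    (hg : ∀ᶠ p in l, g' p = g p) (h₀ : ∀ᶠ p in l, b₀ p = a₀ p) (h₁ : ∀ᶠ p in l, b₁ p = a₁ p)
    (h₂ : ∀ᶠ p in l, b₂ p = a₂ p) (h₃ : ∀ᶠ p in l, b₃ p = a₃ p) :
    HasExpansion l h g' b₀ b₁ b₂ b₃ where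
  bdd₀ := H.bdd₀.congr' (h₀.mono fun _ e => e.symm) .rfl
  bdd₁ := H.bdd₁.congr' (h₁.mono fun _ e => e.symm) .rfl
  bdd₂ := H.bdd₂.congr' (h₂.mono fun _ e => e.symm) .rfl
  bdd₃ := H.bdd₃.congr' (h₃.mono fun _ e => e.symm) .rfl
  rem := by
    refine H.rem.congr' ?_ .rfl
    filter_upwards [hg, h₀, h₁, h₂, h₃] with p e e₀ e₁ e₂ e₃
    rw [e, e₀, e₁, e₂, e₃]

theorem HasExpansion.congr_coeff (H : HasExpansion l h g a₀ a₁ a₂ a₃)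
    (h₀ : ∀ p, b₀ p = a₀ p) (h₁ : ∀ p, b₁ p = a₁ p)
    (h₂ : ∀ p, b₂ p = a₂ p) (h₃ : ∀ p, b₃ p = a₃ p) :
    HasExpansion l h g b₀ b₁ b₂ b₃ :=
  H.congr (.of_forall fun _ => rfl) (.of_forall h₀) (.of_forall h₁) (.of_forall h₂) (.of_forall h₃)

/-- Coefficients may vary with the base point, so a bounded function is its own constant term. -/
theorem HasExpansion.of_bdd (hg : g =O[l] (fun _ => (1 : ℝ))) :
    HasExpansion l h g g (fun _ => 0) (fun _ => 0) (fun _ => 0) where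
  bdd₀ := hg
  bdd₁ := bdd_const 0
  bdd₂ := bdd_const 0
  bdd₃ := bdd_const 0
  rem := by simpa using isBigO_zero _ _

theorem HasExpansion.step :
    HasExpansion l h h (fun _ => 0) (fun _ => 1) (fun _ => 0) (fun _ => 0) where
  bdd₀ := bdd_const 0
  bdd₁ := bdd_const 1
  bdd₂ := bdd_const 0
  bdd₃ := bdd_const 0
  rem := by simpa using isBigO_zero _ _

theorem HasExpansion.const (c : ℝ) :
    HasExpansion l h (fun _ => c) (fun _ => c) (fun _ => 0) (fun _ => 0) (fun _ => 0) :=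
  .of_bdd (bdd_const c)

theorem HasExpansion.add (H : HasExpansion l h g a₀ a₁ a₂ a₃)
    (H' : HasExpansion l h g' b₀ b₁ b₂ b₃) :
    HasExpansion l h (fun p => g p + g' p) (fun p => a₀ p + b₀ p) (fun p => a₁ p + b₁ p)
      (fun p => a₂ p + b₂ p) (fun p => a₃ p + b₃ p) where
  bdd₀ := H.bdd₀.add H'.bdd₀
  bdd₁ := H.bdd₁.add H'.bdd₁
  bdd₂ := H.bdd₂.add H'.bdd₂
  bdd₃ := H.bdd₃.add H'.bdd₃
  rem := (H.rem.add H'.rem).congr_left fun p => by ring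

/-- The expansion is determined by the remainder estimate and the expansion of the polynomial. -/
theorem HasExpansion.of_sub_isBigO (H : HasExpansion l h g a₀ a₁ a₂ a₃)
    (hr : (fun p => g' p - g p) =O[l] fun p => h p ^ 4) :
    HasExpansion l h g' a₀ a₁ a₂ a₃ :=
  { H with rem := (hr.add H.rem).congr_left fun p => by ring }

theorem HasExpansion.poly_bdd (hh : h =O[l] (fun _ => (1 : ℝ)))
    (H : HasExpansion l h g a₀ a₁ a₂ a₃) :
    (fun p => a₀ p + a₁ p * h p + a₂ p * h p ^ 2 + a₃ p * h p ^ 3) =O[l] (fun _ => (1 : ℝ)) :=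
  ((H.bdd₀.add (bdd_mul H.bdd₁ hh)).add (bdd_mul H.bdd₂ (by simpa using hh.pow 2))).add
    (bdd_mul H.bdd₃ (by simpa using hh.pow 3))

theorem HasExpansion.bdd (hh : h =O[l] (fun _ => (1 : ℝ))) (H : HasExpansion l h g a₀ a₁ a₂ a₃) :
    g =O[l] (fun _ => (1 : ℝ)) :=
  ((H.rem.trans (by simpa using hh.pow 4)).add (H.poly_bdd hh)).congr_left fun p => by ring

theorem HasExpansion.mul (hh : h =O[l] (fun _ => (1 : ℝ))) (H : HasExpansion l h g a₀ a₁ a₂ a₃)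
    (H' : HasExpansion l h g' b₀ b₁ b₂ b₃) :
    HasExpansion l h (fun p => g p * g' p) (fun p => a₀ p * b₀ p)
      (fun p => a₀ p * b₁ p + a₁ p * b₀ p) (fun p => a₀ p * b₂ p + a₁ p * b₁ p + a₂ p * b₀ p)
      (fun p => a₀ p * b₃ p + a₁ p * b₂ p + a₂ p * b₁ p + a₃ p * b₀ p) where
  bdd₀ := bdd_mul H.bdd₀ H'.bdd₀
  bdd₁ := (bdd_mul H.bdd₀ H'.bdd₁).add (bdd_mul H.bdd₁ H'.bdd₀)
  bdd₂ := ((bdd_mul H.bdd₀ H'.bdd₂).add (bdd_mul H.bdd₁ H'.bdd₁)).add (bdd_mul H.bdd₂ H'.bdd₀)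
  bdd₃ := (((bdd_mul H.bdd₀ H'.bdd₃).add (bdd_mul H.bdd₁ H'.bdd₂)).add
    (bdd_mul H.bdd₂ H'.bdd₁)).add (bdd_mul H.bdd₃ H'.bdd₀)
  rem := by
    -- With polynomial parts `P`, `Q`: `g g' - P Q = g (g' - Q) + (g - P) Q`; `h3` collects the
    -- terms of degree four to six in `P Q`.
    have h1 : (fun p => g p * (g' p - (b₀ p + b₁ p * h p + b₂ p * h p ^ 2 + b₃ p * h p ^ 3)))
        =O[l] fun p => h p ^ 4 := by simpa using (H.bdd hh).mul H'.rem
    have h2 : (fun p => (g p - (a₀ p + a₁ p * h p + a₂ p * h p ^ 2 + a₃ p * h p ^ 3)) *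
        (b₀ p + b₁ p * h p + b₂ p * h p ^ 2 + b₃ p * h p ^ 3))
        =O[l] fun p => h p ^ 4 := by simpa using H.rem.mul (H'.poly_bdd hh)
    have h3 : (fun p => (a₁ p * b₃ p + a₂ p * b₂ p + a₃ p * b₁ p
        + (a₂ p * b₃ p + a₃ p * b₂ p) * h p + a₃ p * b₃ p * h p ^ 2) * h p ^ 4)
        =O[l] fun p => h p ^ 4 := by
      have hb : (fun p => a₁ p * b₃ p + a₂ p * b₂ p + a₃ p * b₁ p
        + (a₂ p * b₃ p + a₃ p * b₂ p) * h p + a₃ p * b₃ p * h p ^ 2) =O[l] (fun _ => (1 : ℝ)) :=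
        ((((bdd_mul H.bdd₁ H'.bdd₃).add (bdd_mul H.bdd₂ H'.bdd₂)).add
          (bdd_mul H.bdd₃ H'.bdd₁)).add
          (bdd_mul ((bdd_mul H.bdd₂ H'.bdd₃).add (bdd_mul H.bdd₃ H'.bdd₂)) hh)).add
          (bdd_mul (bdd_mul H.bdd₃ H'.bdd₃) (by simpa using hh.pow 2))
      simpa using hb.mul (isBigO_refl (fun p => h p ^ 4) l)
    refine ((h1.add h2).add h3).congr_left fun p => ?_
    ring

theorem HasExpansion.const_mul (hh : h =O[l] (fun _ => (1 : ℝ))) (c : ℝ)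
    (H : HasExpansion l h g a₀ a₁ a₂ a₃) :
    HasExpansion l h (fun p => c * g p) (fun p => c * a₀ p) (fun p => c * a₁ p)
      (fun p => c * a₂ p) (fun p => c * a₃ p) :=
  ((HasExpansion.const c).mul hh H).congr_coeff (fun p => by ring) (fun p => by ring)
    (fun p => by ring) fun p => by ring

theorem HasExpansion.sub (hh : h =O[l] (fun _ => (1 : ℝ))) (H : HasExpansion l h g a₀ a₁ a₂ a₃)
    (H' : HasExpansion l h g' b₀ b₁ b₂ b₃) :
    HasExpansion l h (fun p => g p - g' p) (fun p => a₀ p - b₀ p) (fun p => a₁ p - b₁ p)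
      (fun p => a₂ p - b₂ p) (fun p => a₃ p - b₃ p) :=
  (H.add (H'.const_mul hh (-1))).congr (.of_forall fun p => by ring) (.of_forall fun p => by ring)
    (.of_forall fun p => by ring) (.of_forall fun p => by ring) (.of_forall fun p => by ring)

/-- An expansion with vanishing constant term is `O(h)`. -/
theorem HasExpansion.isBigO_step (hh : h =O[l] (fun _ => (1 : ℝ)))
    (H : HasExpansion l h g (fun _ => 0) a₁ a₂ a₃) : g =O[l] h := by
  have h1 : ∀ {a : α → ℝ} (n : ℕ), a =O[l] (fun _ => (1 : ℝ)) →
      (fun p => a p * h p ^ (1 + n)) =O[l] h := fun n ha => by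
    simpa using ha.mul (pow_isBigO hh 1 n)
  have h4 : (fun p => h p ^ 4) =O[l] h := by simpa using pow_isBigO hh 1 3
  refine ((((h1 0 H.bdd₁).add (h1 1 H.bdd₂)).add (h1 2 H.bdd₃)).add
    (H.rem.trans h4)).congr_left fun p => ?_
  ring

/-- An expansion starting at order three is `O(h³)`. -/
theorem HasExpansion.isBigO_pow_three (hh : h =O[l] (fun _ => (1 : ℝ)))
    (H : HasExpansion l h g (fun _ => 0) (fun _ => 0) (fun _ => 0) a₃) :
    g =O[l] fun p => h p ^ 3 := by
  have h3 : (fun p => a₃ p * h p ^ 3) =O[l] fun p => h p ^ 3 := by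
    simpa using H.bdd₃.mul (isBigO_refl (fun p => h p ^ 3) l)
  exact (h3.add (H.rem.trans (pow_isBigO hh 3 1))).congr_left fun p => by ring

/-- An expansion with vanishing coefficients is `O(h⁴)`. -/
theorem HasExpansion.isBigO_pow_four
    (H : HasExpansion l h g (fun _ => 0) (fun _ => 0) (fun _ => 0) (fun _ => 0)) :
    g =O[l] fun p => h p ^ 4 := by simpa using H.rem

/-! ### Expansions of the square root and its inverse -/

theorem abs_sqrt_one_add_sub_one_le {x : ℝ} (hx : -1 ≤ x) : |√(1 + x) - 1| ≤ |x| := by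
  have hs := Real.sqrt_nonneg (1 + x)
  have e : x = (√(1 + x) - 1) * (√(1 + x) + 1) := by
    have := Real.sq_sqrt (show 0 ≤ 1 + x by linarith)
    linear_combination -this
  conv_rhs => rw [e, abs_mul]
  refine le_mul_of_one_le_right (abs_nonneg _) ?_
  rw [abs_of_nonneg (by positivity)]
  linarith

/-- With `s = √(1 + x)`, so that `x = s² - 1`, the error is exactly `-(s - 1)² / 2`. -/
theorem abs_sqrt_one_add_sub_le {x : ℝ} (hx : -1 ≤ x) : |√(1 + x) - (1 + x / 2)| ≤ x ^ 2 := by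
  have h1 := sq_le_sq.2 (abs_sqrt_one_add_sub_one_le hx)
  have e : √(1 + x) - (1 + x / 2) = -((√(1 + x) - 1) ^ 2 / 2) := by
    have := Real.sq_sqrt (show 0 ≤ 1 + x by linarith)
    linear_combination (1 / 2) * this
  rw [e, abs_neg, abs_of_nonneg (by positivity)]
  linarith [sq_nonneg x]

/-- The error is `(s - 1)² (1/2 + s⁻¹)`; the lower bound on `x` gives `s⁻¹ ≤ 2`, whence `5/2`. -/
theorem abs_inv_sqrt_one_add_sub_le {x : ℝ} (hx : -(1 / 2) ≤ x) :
    |(√(1 + x))⁻¹ - (1 - x / 2)| ≤ 5 / 2 * x ^ 2 := by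
  have h1 := sq_le_sq.2 (abs_sqrt_one_add_sub_one_le (x := x) (by linarith))
  have hs2 : (1 : ℝ) / 2 ≤ √(1 + x) := Real.le_sqrt_of_sq_le (by linarith)
  have hs := Real.sq_sqrt (show 0 ≤ 1 + x by linarith)
  set s := √(1 + x)
  have hpos : 0 < s := by linarith
  have e : s⁻¹ - (1 - x / 2) = (s - 1) ^ 2 * (1 / 2 + s⁻¹) := by
    have : x = s ^ 2 - 1 := by linarith
    rw [this]
    field_simp
    ring
  have hinv : s⁻¹ ≤ 2 := by
    rw [inv_le_comm₀ hpos two_pos]; linarith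
  rw [e, abs_of_nonneg (by positivity)]
  calc (s - 1) ^ 2 * (1 / 2 + s⁻¹) ≤ (s - 1) ^ 2 * (5 / 2) := by gcongr; linarith
    _ ≤ 5 / 2 * x ^ 2 := by linarith

variable {e : α → ℝ}

theorem quadratic_tendsto_zero (hh : Tendsto h l (𝓝 0)) (he : e =O[l] (fun _ => (1 : ℝ))) (c : ℝ) :
    Tendsto (fun p => e p * c ^ 2 * h p ^ 2) l (𝓝 0) := by
  have h1 : (fun p => e p * c ^ 2 * h p ^ 2) =O[l] fun p => h p ^ 2 := by
    simpa using (bdd_mul he (bdd_const (c ^ 2))).mul (isBigO_refl (fun p => h p ^ 2) l)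
  exact h1.trans_tendsto (by simpa using hh.pow 2)

/-- The argument of the radical deviates from `1` by `O(h²)`, so its squared deviation is negligible
and only the linear term of the root survives. -/
theorem quadratic_sq_isBigO (he : e =O[l] (fun _ => (1 : ℝ))) (c : ℝ) :
    (fun p => (e p * c ^ 2 * h p ^ 2) ^ 2) =O[l] fun p => h p ^ 4 := by
  have hb := bdd_mul he (bdd_const (c ^ 2))
  exact ((bdd_mul hb hb).mul (isBigO_refl (fun p => h p ^ 4) l)).congr (fun p => by ring)
    fun p => by ring

theorem hasExpansion_one_add (he : e =O[l] (fun _ => (1 : ℝ))) (c : ℝ) :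
    HasExpansion l h (fun p => 1 + c * e p * h p ^ 2) (fun _ => 1) (fun _ => 0)
      (fun p => c * e p) (fun _ => 0) where
  bdd₀ := bdd_const 1
  bdd₁ := bdd_const 0
  bdd₂ := bdd_mul (bdd_const c) he
  bdd₃ := bdd_const 0
  rem := by simpa using isBigO_zero _ _

theorem hasExpansion_sqrt (hh : Tendsto h l (𝓝 0)) (he : e =O[l] (fun _ => (1 : ℝ))) (c : ℝ) :
    HasExpansion l h (fun p => √(1 + e p * c ^ 2 * h p ^ 2)) (fun _ => 1) (fun _ => 0)
      (fun p => c ^ 2 / 2 * e p) (fun _ => 0) := by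
  refine (hasExpansion_one_add he (c ^ 2 / 2)).of_sub_isBigO
    (IsBigO.trans (IsBigO.of_bound 1 ?_) (quadratic_sq_isBigO he c))
  filter_upwards [(quadratic_tendsto_zero hh he c).eventually (lt_mem_nhds neg_one_lt_zero)]
    with p hp
  rw [Real.norm_eq_abs, Real.norm_eq_abs, abs_of_nonneg (a := (_ : ℝ) ^ 2) (sq_nonneg _), one_mul]
  refine le_trans (le_of_eq ?_) (abs_sqrt_one_add_sub_le hp.le)
  congr 2
  ring

theorem hasExpansion_inv_sqrt (hh : Tendsto h l (𝓝 0)) (he : e =O[l] (fun _ => (1 : ℝ)))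
    (c : ℝ) :
    HasExpansion l h (fun p => (√(1 + e p * c ^ 2 * h p ^ 2))⁻¹) (fun _ => 1) (fun _ => 0)
      (fun p => -(c ^ 2 / 2) * e p) (fun _ => 0) := by
  refine (hasExpansion_one_add he (-(c ^ 2 / 2))).of_sub_isBigO
    (IsBigO.trans (IsBigO.of_bound (5 / 2) ?_) (quadratic_sq_isBigO he c))
  filter_upwards [(quadratic_tendsto_zero hh he c).eventually
    (lt_mem_nhds (show (-(1 / 2) : ℝ) < 0 by norm_num))] with p hp
  rw [Real.norm_eq_abs, Real.norm_eq_abs, abs_of_nonneg (a := (_ : ℝ) ^ 2) (sq_nonneg _)]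
  refine le_trans (le_of_eq ?_) (abs_inv_sqrt_one_add_sub_le hp.le)
  congr 2
  ring

end Expansion

/-! ### Substitution of an expansion into a smooth function -/

section Composition

variable {α : Type*} {l : Filter α} {h t v Y y₁ y₂ y₃ : α → ℝ} {U K : Set (ℝ × ℝ)}
  {F : ℝ → ℝ → ℝ}

theorem SmoothOn.bdd (hF : SmoothOn U F) (hK : IsCompact K) (hKU : K ⊆ U)
    (hp : ∀ᶠ p in l, (t p, v p) ∈ K) :
    (fun p => F (t p) (v p)) =O[l] (fun _ => (1 : ℝ)) := by
  obtain ⟨C, -, hC⟩ := hF.exists_bound hK hKU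
  exact IsBigO.of_bound C (hp.mono fun p h => by simpa using hC _ h)

/-- The third-order Taylor polynomial of `F` in the plane. -/
def taylorThree (F : ℝ → ℝ → ℝ) (x y t v : ℝ) : ℝ :=
  F t v + (x * pt F t v + y * pu F t v)
    + 1 / 2 * (x * x * pt (pt F) t v + 2 * (x * y * pt (pu F) t v) + y * y * pu (pu F) t v)
    + 1 / 6 * (x * x * x * pt (pt (pt F)) t v + 3 * (x * x * y * pt (pt (pu F)) t v)
      + 3 * (x * y * y * pt (pu (pu F)) t v) + y * y * y * pu (pu (pu F)) t v)

theorem sum_dirDeriv_eq (hU : IsOpen U) (hF : SmoothOn U F) {t v : ℝ} (hp : (t, v) ∈ U)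
    (x y : ℝ) :
    ∑ k ∈ Finset.range 4, dirDeriv x y k F t v / (k.factorial : ℝ) = taylorThree F x y t v := by
  have e1 := pu_pt hU hF hp
  have e2 := pu_pt_pt hU hF hp
  have e3 := pu_pt hU (hF.pu hU) hp
  have e4 := pt_congr hU (fun _ hq => pu_pt hU hF hq) hp
  have e5 := (pu_congr hU (fun _ hq => pu_pt hU hF hq) hp).trans e3
  simp only at e1 e2 e3 e4 e5
  simp only [Finset.sum_range_succ, Finset.sum_range_zero, dirDeriv, taylorThree, e1, e2, e3, e4,
    e5, Nat.factorial]
  push_cast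
  ring

/-- Substituting an expansion into a smooth function of two variables. -/
theorem HasExpansion.comp (hU : IsOpen U) (hF : SmoothOn U F) (hK : IsCompact K) (hKU : K ⊆ U)
    (hp : ∀ᶠ p in l, (t p, v p) ∈ K) (hh : Tendsto h l (𝓝 0)) (c : ℝ)
    (hY : HasExpansion l h Y v y₁ y₂ y₃) :
    HasExpansion l h (fun p => F (t p + c * h p) (Y p)) (fun p => F (t p) (v p))
      (fun p => c * pt F (t p) (v p) + y₁ p * pu F (t p) (v p))
      (fun p => y₂ p * pu F (t p) (v p) + 1 / 2 * (c ^ 2 * pt (pt F) (t p) (v p)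
        + 2 * c * y₁ p * pt (pu F) (t p) (v p) + y₁ p ^ 2 * pu (pu F) (t p) (v p)))
      (fun p => y₃ p * pu F (t p) (v p) + c * y₂ p * pt (pu F) (t p) (v p)
        + y₁ p * y₂ p * pu (pu F) (t p) (v p)
        + 1 / 6 * (c ^ 3 * pt (pt (pt F)) (t p) (v p)
          + 3 * c ^ 2 * y₁ p * pt (pt (pu F)) (t p) (v p)
          + 3 * c * y₁ p ^ 2 * pt (pu (pu F)) (t p) (v p)
          + y₁ p ^ 3 * pu (pu (pu F)) (t p) (v p))) := by
  have hb : h =O[l] (fun _ => (1 : ℝ)) := hh.isBigO_one ℝ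
  have hx : HasExpansion l h (fun p => c * h p) (fun _ => 0) (fun _ => c) (fun _ => 0)
      (fun _ => 0) := by
    simpa using HasExpansion.step.const_mul hb c
  have hy : HasExpansion l h (fun p => Y p - v p) (fun _ => 0) y₁ y₂ y₃ := by
    simpa using hY.sub hb (HasExpansion.of_bdd hY.bdd₀)
  have hE : ∀ G, SmoothOn U G → HasExpansion l h (fun p => G (t p) (v p))
      (fun p => G (t p) (v p)) (fun _ => 0) (fun _ => 0) (fun _ => 0) :=
    fun G hG => .of_bdd (hG.bdd hK hKU hp)
  have hft := hF.pt hU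
  have hfu := hF.pu hU
  have hxx := hx.mul hb hx
  have hxy := hx.mul hb hy
  have hyy := hy.mul hb hy
  -- Expansion of `taylorThree` at the displacements `c h` and `Y - v`.
  have hT := (((hE F hF).add ((hx.mul hb (hE _ hft)).add (hy.mul hb (hE _ hfu)))).add
      ((((hxx.mul hb (hE _ (hft.pt hU))).add
        ((hxy.mul hb (hE _ (hfu.pt hU))).const_mul hb 2)).add
        (hyy.mul hb (hE _ (hfu.pu hU)))).const_mul hb (1 / 2))).add
      ((((((hxx.mul hb hx).mul hb (hE _ ((hft.pt hU).pt hU))).add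
        (((hxx.mul hb hy).mul hb (hE _ ((hfu.pt hU).pt hU))).const_mul hb 3)).add
        (((hxy.mul hb hy).mul hb (hE _ ((hfu.pu hU).pt hU))).const_mul hb 3)).add
        ((hyy.mul hb hy).mul hb (hE _ ((hfu.pu hU).pu hU)))).const_mul hb (1 / 6))
  -- Both displacements are `O(h)`, so they eventually stay below `δ` and the fourth-order Taylor
  -- remainder is `O(h⁴)`.
  have hr : (fun p => F (t p + c * h p) (Y p)
      - taylorThree F (c * h p) (Y p - v p) (t p) (v p)) =O[l] fun p => h p ^ 4 := by
    obtain ⟨C, δ, hδ, hC⟩ := exists_taylor_bound hU hF hK hKU 4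
    have ox := hx.isBigO_step hb
    have oy := hy.isBigO_step hb
    have small : ∀ {z : α → ℝ}, z =O[l] h → ∀ᶠ p in l, |z p| ≤ δ := fun hz => by
      filter_upwards [(hz.trans_tendsto hh).abs.eventually
        (ge_mem_nhds (show |(0 : ℝ)| < δ by simpa))] with p hp using hp
    have ho : (fun p => (|c * h p| + |Y p - v p|) ^ 4) =O[l] fun p => h p ^ 4 :=
      ((ox.abs_left).add oy.abs_left).pow 4
    refine IsBigO.trans (IsBigO.of_bound C ?_) ho
    filter_upwards [hp, small ox, small oy] with p hp h1 h2
    have := hC (t p) (v p) _ _ hp h1 h2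
    rw [sum_dirDeriv_eq hU hF (hKU hp), add_sub_cancel] at this
    rwa [Real.norm_eq_abs, Real.norm_eq_abs, abs_of_nonneg (a := (_ + _) ^ 4) (by positivity)]
  exact (hT.of_sub_isBigO hr).congr_coeff (fun p => by ring) (fun p => by ring)
    (fun p => by ring) fun p => by ring

end Composition

/-! ### The filter of small steps -/

/-- Steps `(t, h)` with `[t, t + h] ⊆ [a, b]` and `h → 0⁺`. -/
def stepFilter (a b : ℝ) : Filter (ℝ × ℝ) :=
  𝓟 {p | a ≤ p.1 ∧ p.1 + p.2 ≤ b} ⊓ comap Prod.snd (𝓝[>] 0)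

section StepFilter

variable {a b : ℝ}

theorem tendsto_step : Tendsto (fun p : ℝ × ℝ => p.2) (stepFilter a b) (𝓝 0) :=
  (tendsto_comap.mono_left inf_le_right).mono_right nhdsWithin_le_nhds

theorem eventually_step_pos : ∀ᶠ p in stepFilter a b, 0 < p.2 :=
  (tendsto_comap.mono_left inf_le_right).eventually self_mem_nhdsWithin

theorem eventually_step_subset : ∀ᶠ p in stepFilter a b, a ≤ p.1 ∧ p.1 + p.2 ≤ b :=
  mem_inf_of_left (mem_principal_self _)

theorem eventually_mem_Icc : ∀ᶠ p in stepFilter a b, p.1 ∈ Icc a b := by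
  filter_upwards [eventually_step_pos, eventually_step_subset] with p h0 h1
  exact ⟨h1.1, by linarith⟩

/-- The filter shrinks only `h` and never localizes `t`, so an eventual bound yields one `h₀` for
all base points. -/
theorem OrderOn.of_isBigO {n : ℕ} {τ : ℝ → ℝ → ℝ}
    (h : (fun p : ℝ × ℝ => τ p.1 p.2) =O[stepFilter a b] fun p => p.2 ^ n) : OrderOn a b n τ := by
  obtain ⟨C, hC⟩ := h.bound
  rw [stepFilter, inf_comm, eventually_inf_principal,
    eventually_comap] at hC
  obtain ⟨δ, hδ, hs⟩ := (mem_nhdsGT_iff_exists_Ioo_subset (a := (0 : ℝ))).1 hC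
  refine ⟨C, δ, hδ, fun t h h0 hlt ha hb => ?_⟩
  have := hs ⟨h0, hlt⟩ (t, h) rfl ⟨ha, hb⟩
  simpa [abs_of_pos h0] using this

end StepFilter

/-! ### Taylor expansion of the exact solution -/

section Solution

variable {U : Set (ℝ × ℝ)} {f F G : ℝ → ℝ → ℝ}

theorem SmoothOn.const (c : ℝ) : SmoothOn U fun _ _ => c := contDiffOn_const

theorem SmoothOn.snd : SmoothOn U fun _ v => v := contDiff_snd.contDiffOn

theorem SmoothOn.add (hF : SmoothOn U F) (hG : SmoothOn U G) :
    SmoothOn U fun t v => F t v + G t v := ContDiffOn.add hF hG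

theorem SmoothOn.mul (hF : SmoothOn U F) (hG : SmoothOn U G) :
    SmoothOn U fun t v => F t v * G t v := ContDiffOn.mul hF hG

theorem SmoothOn.pow (hF : SmoothOn U F) (n : ℕ) :
    SmoothOn U fun t v => F t v ^ n := ContDiffOn.pow hF n

/-- The second derivative of a solution of `u' = f(t, u)`. -/
def solD2 (f : ℝ → ℝ → ℝ) (t v : ℝ) : ℝ := pt f t v + f t v * pu f t v

/-- The third derivative of a solution of `u' = f(t, u)`. -/
def solD3 (f : ℝ → ℝ → ℝ) (t v : ℝ) : ℝ :=
  pt (pt f) t v + 2 * f t v * pt (pu f) t v + f t v ^ 2 * pu (pu f) t v + pu f t v * solD2 f t v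

/-- The fourth derivative of a solution of `u' = f(t, u)`. -/
def solD4 (f : ℝ → ℝ → ℝ) (t v : ℝ) : ℝ :=
  pt (pt (pt f)) t v + 3 * f t v * pt (pt (pu f)) t v + 3 * f t v ^ 2 * pt (pu (pu f)) t v
    + f t v ^ 3 * pu (pu (pu f)) t v
    + 3 * solD2 f t v * (pt (pu f) t v + f t v * pu (pu f) t v) + pu f t v * solD3 f t v

theorem SmoothOn.solD2 (hU : IsOpen U) (hf : SmoothOn U f) : SmoothOn U (solD2 f) :=
  (hf.pt hU).add (hf.mul (hf.pu hU))

theorem SmoothOn.solD3 (hU : IsOpen U) (hf : SmoothOn U f) : SmoothOn U (solD3 f) :=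
  (((((hf.pt hU).pt hU).add (((SmoothOn.const 2).mul hf).mul ((hf.pu hU).pt hU))).add
    ((hf.pow 2).mul ((hf.pu hU).pu hU))).add ((hf.pu hU).mul (hf.solD2 hU)))

theorem SmoothOn.solD4 (hU : IsOpen U) (hf : SmoothOn U f) : SmoothOn U (solD4 f) :=
  (((((((hf.pt hU).pt hU).pt hU).add
    (((SmoothOn.const 3).mul hf).mul (((hf.pu hU).pt hU).pt hU))).add
    (((SmoothOn.const 3).mul (hf.pow 2)).mul (((hf.pu hU).pu hU).pt hU))).add
    ((hf.pow 3).mul (((hf.pu hU).pu hU).pu hU))).add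
    (((SmoothOn.const 3).mul (hf.solD2 hU)).mul
      (((hf.pu hU).pt hU).add (hf.mul ((hf.pu hU).pu hU))))).add
    ((hf.pu hU).mul (hf.solD3 hU))

variable {a b : ℝ} {u : ℝ → ℝ}

theorem hasDerivWithinAt_along (hU : IsOpen U) (hF : SmoothOn U F) {S : Set ℝ} {t : ℝ}
    (ht : (t, u t) ∈ U) (hu : HasDerivWithinAt u (f t (u t)) S t) :
    HasDerivWithinAt (fun s => F s (u s)) (pt F t (u t) + f t (u t) * pu F t (u t)) S t := by
  simpa using hF.hasDerivWithinAt_comp hU (hasDerivWithinAt_id t S) hu ht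

theorem hasDerivWithinAt_solD2 (hU : IsOpen U) (hf : SmoothOn U f) {S : Set ℝ} {t : ℝ}
    (ht : (t, u t) ∈ U) (hu : HasDerivWithinAt u (f t (u t)) S t) :
    HasDerivWithinAt (fun s => solD2 f s (u s)) (solD3 f t (u t)) S t := by
  have H : ∀ {F}, SmoothOn U F → _ := fun hF => hasDerivWithinAt_along hU hF ht hu
  have e1 := pu_pt hU hf ht
  simp only at e1
  refine ((H (hf.pt hU)).add ((H hf).mul (H (hf.pu hU)))).congr_deriv ?_
  rw [e1, solD3, solD2]
  ring

theorem hasDerivWithinAt_solD3 (hU : IsOpen U) (hf : SmoothOn U f) {S : Set ℝ} {t : ℝ}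
    (ht : (t, u t) ∈ U) (hu : HasDerivWithinAt u (f t (u t)) S t) :
    HasDerivWithinAt (fun s => solD3 f s (u s)) (solD4 f t (u t)) S t := by
  have H : ∀ {F}, SmoothOn U F → _ := fun hF => hasDerivWithinAt_along hU hF ht hu
  have e1 := pu_pt hU hf ht
  have e2 := pu_pt_pt hU hf ht
  have e3 := pu_pt hU (hf.pu hU) ht
  simp only at e1 e2 e3
  have hfu := hf.pu hU
  refine (((((H ((hf.pt hU).pt hU)).add (((H hf).const_mul 2).mul (H (hfu.pt hU)))).add
    (((H hf).pow 2).mul (H (hfu.pu hU)))).add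
    ((H hfu).mul (hasDerivWithinAt_solD2 hU hf ht hu)))).congr_deriv ?_
  simp only [Pi.pow_apply, e2, e3, solD4, solD3, solD2]
  push_cast
  ring

/-- The successive derivatives of a solution of `u' = f(t, u)`, up to the fifth. -/
def solDeriv (f : ℝ → ℝ → ℝ) : ℕ → ℝ → ℝ → ℝ
  | 0 => fun _ v => v
  | 1 => f
  | 2 => solD2 f
  | 3 => solD3 f
  | 4 => solD4 f
  -- This is the next derivative only at index five; larger indices are never used.
  | _ => fun t v => pt (solD4 f) t v + f t v * pu (solD4 f) t v

theorem hasDerivWithinAt_solDeriv (hU : IsOpen U) (hf : SmoothOn U f) {S : Set ℝ} {t : ℝ}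
    (ht : (t, u t) ∈ U) (hu : HasDerivWithinAt u (f t (u t)) S t) {k : ℕ} (hk : k < 5) :
    HasDerivWithinAt (fun s => solDeriv f k s (u s)) (solDeriv f (k + 1) t (u t)) S t := by
  interval_cases k
  · exact hu
  · exact hasDerivWithinAt_along hU hf ht hu
  · exact hasDerivWithinAt_solD2 hU hf ht hu
  · exact hasDerivWithinAt_solD3 hU hf ht hu
  · exact hasDerivWithinAt_along hU (hf.solD4 hU) ht hu

/-- Order five is needed because the truncation error divides by `h`. Derivatives within the
interval suffice, so steps touching `a` or `b` are included. -/
theorem abs_solution_sub_taylor_le (hU : IsOpen U) (hf : SmoothOn U f)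
    (hgraph : ∀ t ∈ Icc a b, (t, u t) ∈ U)
    (hu : ∀ t ∈ Icc a b, HasDerivWithinAt u (f t (u t)) (Icc a b) t) {C : ℝ}
    (hC : ∀ t ∈ Icc a b, |solDeriv f 5 t (u t)| ≤ C) {t h : ℝ} (h0 : 0 < h) (ha : a ≤ t)
    (hb : t + h ≤ b) :
    |u (t + h) - ∑ k ∈ Finset.range 5, solDeriv f k t (u t) * h ^ k / (k.factorial : ℝ)|
      ≤ C * h ^ 5 / ((Nat.factorial 5 : ℕ) : ℝ) := by
  have hmem : MapsTo (fun s => t + s) (Icc 0 h) (Icc a b) := fun s hs =>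
    ⟨by linarith [hs.1], by linarith [hs.2]⟩
  have key := abs_sub_taylor_le (H := h) (C := C) 5
    (fun k s => solDeriv f k (t + s) (u (t + s))) (fun k hk s hs => ?_)
    (fun s hs => hC _ (hmem hs)) h ⟨h0.le, le_rfl⟩
  · simp only [add_zero] at key
    exact key
  · have h2 : HasDerivWithinAt (fun r : ℝ => t + r) 1 (Icc 0 h) s :=
      (hasDerivWithinAt_id s (Icc 0 h)).const_add t
    have h3 := (hasDerivWithinAt_solDeriv hU hf (hgraph _ (hmem hs)) (hu _ (hmem hs)) hk).scomp
      s h2 hmem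
    rwa [one_smul] at h3

theorem abs_solution_quotient_le (hU : IsOpen U) (hf : SmoothOn U f)
    (hgraph : ∀ t ∈ Icc a b, (t, u t) ∈ U)
    (hu : ∀ t ∈ Icc a b, HasDerivWithinAt u (f t (u t)) (Icc a b) t) {C : ℝ}
    (hC : ∀ t ∈ Icc a b, |solDeriv f 5 t (u t)| ≤ C) {t h : ℝ} (h0 : 0 < h) (ha : a ≤ t)
    (hb : t + h ≤ b) :
    |(u (t + h) - u t) / h - (f t (u t) + solD2 f t (u t) / 2 * h
      + solD3 f t (u t) / 6 * h ^ 2 + solD4 f t (u t) / 24 * h ^ 3)| ≤ C / 120 * h ^ 4 := by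
  have key := abs_solution_sub_taylor_le hU hf hgraph hu hC h0 ha hb
  have h5 : ((Nat.factorial 5 : ℕ) : ℝ) = 120 := by norm_num [Nat.factorial]
  rw [h5] at key
  have hS : ∑ k ∈ Finset.range 5, solDeriv f k t (u t) * h ^ k / (k.factorial : ℝ)
      = u t + f t (u t) * h + solD2 f t (u t) * h ^ 2 / 2 + solD3 f t (u t) * h ^ 3 / 6
        + solD4 f t (u t) * h ^ 4 / 24 := by
    simp [Finset.sum_range_succ, solDeriv, Nat.factorial]
  rw [hS] at key
  have e : (u (t + h) - u t) / h - (f t (u t) + solD2 f t (u t) / 2 * h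
      + solD3 f t (u t) / 6 * h ^ 2 + solD4 f t (u t) / 24 * h ^ 3)
      = (u (t + h) - (u t + f t (u t) * h + solD2 f t (u t) * h ^ 2 / 2
        + solD3 f t (u t) * h ^ 3 / 6 + solD4 f t (u t) * h ^ 4 / 24)) / h := by
    field_simp
    ring
  rw [e, abs_div, abs_of_pos h0, div_le_iff₀ h0]
  exact key.trans (le_of_eq (by ring))

theorem hasExpansion_solution (hU : IsOpen U) (hf : SmoothOn U f)
    (hgraph : ∀ t ∈ Icc a b, (t, u t) ∈ U)
    (hu : ∀ t ∈ Icc a b, HasDerivWithinAt u (f t (u t)) (Icc a b) t)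
    {K : Set (ℝ × ℝ)} (hK : IsCompact K) (hKU : K ⊆ U) (hgK : ∀ t ∈ Icc a b, (t, u t) ∈ K) :
    HasExpansion (stepFilter a b) (fun p => p.2) (fun p => (u (p.1 + p.2) - u p.1) / p.2)
      (fun p => f p.1 (u p.1)) (fun p => solD2 f p.1 (u p.1) / 2)
      (fun p => solD3 f p.1 (u p.1) / 6) (fun p => solD4 f p.1 (u p.1) / 24) := by
  have hev : ∀ᶠ p in stepFilter a b, (p.1, u p.1) ∈ K :=
    eventually_mem_Icc.mono fun p hp => hgK _ hp
  have hB : ∀ G, SmoothOn U G → ∀ c : ℝ, (fun p : ℝ × ℝ => G p.1 (u p.1) / c)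
      =O[stepFilter a b] (fun _ => (1 : ℝ)) := fun G hG c => by
    simpa only [div_eq_mul_inv] using bdd_mul (hG.bdd hK hKU hev) (bdd_const c⁻¹)
  have hD5 : SmoothOn U (solDeriv f 5) :=
    ((hf.solD4 hU).pt hU).add (hf.mul ((hf.solD4 hU).pu hU))
  obtain ⟨C, hC0, hC⟩ := hD5.exists_bound hK hKU
  refine ⟨hf.bdd hK hKU hev, hB _ (hf.solD2 hU) 2, hB _ (hf.solD3 hU) 6,
    hB _ (hf.solD4 hU) 24, IsBigO.of_bound (C / 120) ?_⟩
  filter_upwards [eventually_step_pos, eventually_step_subset] with p h0 hp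
  have key := abs_solution_quotient_le hU hf hgraph hu
    (fun t ht => hC (t, u t) (hgK t ht)) h0 hp.1 hp.2
  rwa [Real.norm_eq_abs, Real.norm_eq_abs, abs_of_pos (pow_pos h0 4)]

end Solution

/-! ### Expansion of the stages and of the truncation error -/

section Stages

variable {α : Type*} {l : Filter α} {h t v e k κ₀ κ₁ κ₂ κ₃ : α → ℝ}

/-- The factor `1 *` is the sign `σ` of `hasExpansion_truncation`. Both methods multiply `h K` by
the radical, but IMQ divides `v` by it, so only the term in `v` changes sign. -/
theorem hasExpansion_mq_stage (hh : Tendsto h l (𝓝 0)) (he : e =O[l] (fun _ => (1 : ℝ)))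
    (hv : v =O[l] (fun _ => (1 : ℝ))) (c : ℝ) (hk : HasExpansion l h k κ₀ κ₁ κ₂ κ₃) :
    HasExpansion l h (fun p => (v p + h p * k p) * √(1 + e p * c ^ 2 * h p ^ 2)) v κ₀
      (fun p => κ₁ p + 1 * (c ^ 2 / 2 * e p) * v p)
      (fun p => κ₂ p + c ^ 2 / 2 * e p * κ₀ p) := by
  have hb : h =O[l] (fun _ => (1 : ℝ)) := hh.isBigO_one ℝ
  exact (((HasExpansion.of_bdd hv).add (HasExpansion.step.mul hb hk)).mul hb
    (hasExpansion_sqrt hh he c)).congr_coeff (fun p => by ring) (fun p => by ring)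
    (fun p => by ring) fun p => by ring

theorem hasExpansion_imq_stage (hh : Tendsto h l (𝓝 0)) (he : e =O[l] (fun _ => (1 : ℝ)))
    (hv : v =O[l] (fun _ => (1 : ℝ))) (c : ℝ) (hk : HasExpansion l h k κ₀ κ₁ κ₂ κ₃) :
    HasExpansion l h (fun p => √(1 + e p * c ^ 2 * h p ^ 2) * (h p * k p)
        + v p / √(1 + e p * c ^ 2 * h p ^ 2)) v κ₀
      (fun p => κ₁ p + -1 * (c ^ 2 / 2 * e p) * v p)
      (fun p => κ₂ p + c ^ 2 / 2 * e p * κ₀ p) := by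
  have hb : h =O[l] (fun _ => (1 : ℝ)) := hh.isBigO_one ℝ
  simp only [div_eq_mul_inv (v _)]
  exact (((hasExpansion_sqrt hh he c).mul hb (HasExpansion.step.mul hb hk)).add
    ((HasExpansion.of_bdd hv).mul hb (hasExpansion_inv_sqrt hh he c))).congr_coeff
    (fun p => by ring) (fun p => by ring) (fun p => by ring) fun p => by ring

/-- The `h²` coefficient of `f(t + c h, v + y₁ h + y₂ h² + ⋯)`. -/
def stageTwo (f : ℝ → ℝ → ℝ) (c y₁ y₂ t v : ℝ) : ℝ :=
  y₂ * pu f t v + 1 / 2 * (c ^ 2 * pt (pt f) t v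
    + 2 * c * y₁ * pt (pu f) t v + y₁ ^ 2 * pu (pu f) t v)

/-- The `h³` coefficient of `f(t + c h, v + y₁ h + y₂ h² + y₃ h³ + ⋯)`. -/
def stageThree (f : ℝ → ℝ → ℝ) (c y₁ y₂ y₃ t v : ℝ) : ℝ :=
  y₃ * pu f t v + c * y₂ * pt (pu f) t v + y₁ * y₂ * pu (pu f) t v
    + 1 / 6 * (c ^ 3 * pt (pt (pt f)) t v + 3 * c ^ 2 * y₁ * pt (pt (pu f)) t v
      + 3 * c * y₁ ^ 2 * pt (pu (pu f)) t v + y₁ ^ 3 * pu (pu (pu f)) t v)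

/-- The `h³` coefficient of the truncation error; the sign `σ` is `1` for the MQ and `-1` for the
IMQ method. -/
def defect (A : Tableau) (σ : ℝ) (f : ℝ → ℝ → ℝ) (e2 e3 t v : ℝ) : ℝ :=
  solD4 f t v / 24
    - (A.b2 * stageThree f A.c2 (A.a21 * f t v) (σ * (A.c2 ^ 2 / 2 * e2) * v)
        (A.c2 ^ 2 / 2 * e2 * (A.a21 * f t v)) t v
      + A.b3 * stageThree f A.c3 (A.a31 * f t v + A.a32 * f t v)
        (A.a32 * (A.c2 * pt f t v + A.a21 * f t v * pu f t v) + σ * (A.c3 ^ 2 / 2 * e3) * v)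
        (A.a32 * stageTwo f A.c2 (A.a21 * f t v) (σ * (A.c2 ^ 2 / 2 * e2) * v) t v
          + A.c3 ^ 2 / 2 * e3 * (A.a31 * f t v + A.a32 * f t v)) t v)

variable {U K : Set (ℝ × ℝ)} {f : ℝ → ℝ → ℝ}

/-- The stages are described by their arguments `Y2`, and `Y3` as a function of the value of the
second stage. -/
theorem hasExpansion_truncation (hU : IsOpen U) (hf : SmoothOn U f) (hK : IsCompact K)
    (hKU : K ⊆ U) (hp : ∀ᶠ p in l, (t p, v p) ∈ K) (hh : Tendsto h l (𝓝 0))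
    {A : Tableau} (hA : A.ThirdOrderConditions) (σ : ℝ) {e2 e3 Y2 Y3 q : α → ℝ}
    (hsh : ∀ᶠ p in l, A.ShapeCondition (e2 p) (e3 p))
    (hq : HasExpansion l h q (fun p => f (t p) (v p)) (fun p => solD2 f (t p) (v p) / 2)
      (fun p => solD3 f (t p) (v p) / 6) (fun p => solD4 f (t p) (v p) / 24))
    (hY2 : ∀ {k κ₀ κ₁ κ₂ κ₃ : α → ℝ}, HasExpansion l h k κ₀ κ₁ κ₂ κ₃ →
      (∀ p, k p = A.a21 * f (t p) (v p)) →
      HasExpansion l h Y2 v κ₀ (fun p => κ₁ p + σ * (A.c2 ^ 2 / 2 * e2 p) * v p)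
        (fun p => κ₂ p + A.c2 ^ 2 / 2 * e2 p * κ₀ p))
    (hY3 : ∀ {k κ₀ κ₁ κ₂ κ₃ : α → ℝ}, HasExpansion l h k κ₀ κ₁ κ₂ κ₃ →
      (∀ p, k p = A.a31 * f (t p) (v p) + A.a32 * f (t p + A.c2 * h p) (Y2 p)) →
      HasExpansion l h Y3 v κ₀ (fun p => κ₁ p + σ * (A.c3 ^ 2 / 2 * e3 p) * v p)
        (fun p => κ₂ p + A.c3 ^ 2 / 2 * e3 p * κ₀ p)) :
    HasExpansion l h (fun p => q p - (A.b1 * f (t p) (v p)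
        + A.b2 * f (t p + A.c2 * h p) (Y2 p) + A.b3 * f (t p + A.c3 * h p) (Y3 p)))
      (fun _ => 0) (fun _ => 0) (fun _ => 0)
      (fun p => defect A σ f (e2 p) (e3 p) (t p) (v p)) := by
  have hb : h =O[l] (fun _ => (1 : ℝ)) := hh.isBigO_one ℝ
  have hk1 : HasExpansion l h (fun p => f (t p) (v p)) _ _ _ _ := .of_bdd (hf.bdd hK hKU hp)
  have hk2 := HasExpansion.comp hU hf hK hKU hp hh A.c2 (hY2 (hk1.const_mul hb A.a21) fun _ => rfl)
  have hk3 := HasExpansion.comp hU hf hK hKU hp hh A.c3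
    (hY3 ((hk1.const_mul hb A.a31).add (hk2.const_mul hb A.a32)) fun _ => rfl)
  have H := hq.sub hb (((hk1.const_mul hb A.b1).add (hk2.const_mul hb A.b2)).add
    (hk3.const_mul hb A.b3))
  obtain ⟨s0, r2, r3, s1, s2, s3⟩ := hA
  refine H.congr (.of_forall fun _ => rfl) (.of_forall fun p => ?_) (.of_forall fun p => ?_)
    ?_ (.of_forall fun p => ?_)
  · linear_combination f (t p) (v p) * s0
  · simp only [solD2, r3, r2, ← add_mul]
    linear_combination (pt f (t p) (v p) + f (t p) (v p) * pu f (t p) (v p)) * s1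
  · filter_upwards [hsh] with p hp
    unfold Tableau.ShapeCondition at hp
    simp only [solD3, solD2, r3, r2, ← add_mul]
    -- The two classical conditions weight the elementary differentials of order three; the shape
    -- condition weights `v f_u`.
    linear_combination (1 / 2 * (pt (pt f) (t p) (v p) + 2 * f (t p) (v p) * pt (pu f) (t p) (v p)
      + f (t p) (v p) ^ 2 * pu (pu f) (t p) (v p))) * s2
      + pu f (t p) (v p) * (pt f (t p) (v p) + f (t p) (v p) * pu f (t p) (v p)) * s3
      + 1 / 2 * σ * v p * pu f (t p) (v p) * hp
  · simp only [defect, stageTwo, stageThree]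
    ring

end Stages

/-! ### Truncation errors along the graph and reduction to an identity -/

section Methods

variable {U : Set (ℝ × ℝ)} {f : ℝ → ℝ → ℝ} {a b : ℝ} {u : ℝ → ℝ}

/-- The graph of `u` over `[a, b]`. -/
def graphOn (u : ℝ → ℝ) (a b : ℝ) : Set (ℝ × ℝ) := (fun t => (t, u t)) '' Icc a b

theorem isCompact_graphOn (hc : ContinuousOn u (Icc a b)) : IsCompact (graphOn u a b) :=
  isCompact_Icc.image_of_continuousOn (continuousOn_id.prodMk hc)

theorem mem_graphOn {t : ℝ} (ht : t ∈ Icc a b) : (t, u t) ∈ graphOn u a b := ⟨t, ht, rfl⟩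

theorem graphOn_subset (hgraph : ∀ t ∈ Icc a b, (t, u t) ∈ U) : graphOn u a b ⊆ U := by
  rintro _ ⟨t, ht, rfl⟩
  exact hgraph t ht

theorem bdd_along {e : ℝ → ℝ → ℝ} {C : ℝ} (he : ∀ t ∈ Icc a b, |e t (u t)| ≤ C) :
    (fun p : ℝ × ℝ => e p.1 (u p.1)) =O[stepFilter a b] (fun _ => (1 : ℝ)) :=
  IsBigO.of_bound C (eventually_mem_Icc.mono fun p hp => by simpa using he _ hp)

variable {A : Tableau} {e2 e3 : ℝ → ℝ → ℝ} {C : ℝ}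

theorem hasExpansion_mqTruncation (hU : IsOpen U) (hf : SmoothOn U f)
    (hgraph : ∀ t ∈ Icc a b, (t, u t) ∈ U)
    (hu : ∀ t ∈ Icc a b, HasDerivWithinAt u (f t (u t)) (Icc a b) t)
    (hA : A.ThirdOrderConditions)
    (h2 : ∀ t ∈ Icc a b, |e2 t (u t)| ≤ C) (h3 : ∀ t ∈ Icc a b, |e3 t (u t)| ≤ C)
    (hsh : ∀ t ∈ Icc a b, A.ShapeCondition (e2 t (u t)) (e3 t (u t))) :
    HasExpansion (stepFilter a b) (fun p => p.2) (fun p => mqTruncation A f e2 e3 u p.1 p.2)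
      (fun _ => 0) (fun _ => 0) (fun _ => 0)
      (fun p => defect A 1 f (e2 p.1 (u p.1)) (e3 p.1 (u p.1)) p.1 (u p.1)) := by
  have hK := isCompact_graphOn fun t ht => (hu t ht).continuousWithinAt
  have hKU := graphOn_subset hgraph
  have hev : ∀ᶠ p in stepFilter a b, (p.1, u p.1) ∈ graphOn u a b :=
    eventually_mem_Icc.mono fun p hp => mem_graphOn hp
  have hv : (fun p : ℝ × ℝ => u p.1) =O[stepFilter a b] (fun _ => (1 : ℝ)) :=
    SmoothOn.snd.bdd hK hKU hev
  refine hasExpansion_truncation (t := fun p => p.1) (v := fun p => u p.1)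
    (e2 := fun p => e2 p.1 (u p.1)) (e3 := fun p => e3 p.1 (u p.1)) hU hf hK hKU hev tendsto_step
    hA 1 (eventually_mem_Icc.mono fun p hp => hsh _ hp)
    (hasExpansion_solution hU hf hgraph hu hK hKU fun t ht => mem_graphOn ht)
    (fun hk ek => ?_) (fun hk ek => ?_)
  -- With `k` identified, the stage argument has the form treated by the stage lemma.
  · obtain rfl := funext ek
    exact hasExpansion_mq_stage tendsto_step (bdd_along h2) hv A.c2 hk
  · obtain rfl := funext ek
    exact hasExpansion_mq_stage tendsto_step (bdd_along h3) hv A.c3 hk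

theorem hasExpansion_imqTruncation (hU : IsOpen U) (hf : SmoothOn U f)
    (hgraph : ∀ t ∈ Icc a b, (t, u t) ∈ U)
    (hu : ∀ t ∈ Icc a b, HasDerivWithinAt u (f t (u t)) (Icc a b) t)
    (hA : A.ThirdOrderConditions)
    (h2 : ∀ t ∈ Icc a b, |e2 t (u t)| ≤ C) (h3 : ∀ t ∈ Icc a b, |e3 t (u t)| ≤ C)
    (hsh : ∀ t ∈ Icc a b, A.ShapeCondition (e2 t (u t)) (e3 t (u t))) :
    HasExpansion (stepFilter a b) (fun p => p.2) (fun p => imqTruncation A f e2 e3 u p.1 p.2)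
      (fun _ => 0) (fun _ => 0) (fun _ => 0)
      (fun p => defect A (-1) f (e2 p.1 (u p.1)) (e3 p.1 (u p.1)) p.1 (u p.1)) := by
  have hK := isCompact_graphOn fun t ht => (hu t ht).continuousWithinAt
  have hKU := graphOn_subset hgraph
  have hev : ∀ᶠ p in stepFilter a b, (p.1, u p.1) ∈ graphOn u a b :=
    eventually_mem_Icc.mono fun p hp => mem_graphOn hp
  have hv : (fun p : ℝ × ℝ => u p.1) =O[stepFilter a b] (fun _ => (1 : ℝ)) :=
    SmoothOn.snd.bdd hK hKU hev
  refine hasExpansion_truncation (t := fun p => p.1) (v := fun p => u p.1)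
    (e2 := fun p => e2 p.1 (u p.1)) (e3 := fun p => e3 p.1 (u p.1)) hU hf hK hKU hev tendsto_step
    hA (-1) (eventually_mem_Icc.mono fun p hp => hsh _ hp)
    (hasExpansion_solution hU hf hgraph hu hK hKU fun t ht => mem_graphOn ht)
    (fun hk ek => ?_) (fun hk ek => ?_)
  · obtain rfl := funext ek
    exact hasExpansion_imq_stage tendsto_step (bdd_along h2) hv A.c2 hk
  · obtain rfl := funext ek
    exact hasExpansion_imq_stage tendsto_step (bdd_along h3) hv A.c3 hk

variable {M : Method}

theorem Method.exists_eps_bound (hc : ContinuousOn u (Icc a b))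
    (hgraph : ∀ t ∈ Icc a b, (t, u t) ∈ U) (hnum : SmoothOn U (M.num f))
    (hden : SmoothOn U (M.den f)) (h0 : ∀ t ∈ Icc a b, M.den f t (u t) ≠ 0) :
    ∃ C, (∀ t ∈ Icc a b, |M.eps2 f t (u t)| ≤ C) ∧ ∀ t ∈ Icc a b, |M.eps3 f t (u t)| ≤ C := by
  have hKU := graphOn_subset hgraph
  have hcont := (ContDiffOn.continuousOn hnum |>.mono hKU).div
    (ContDiffOn.continuousOn hden |>.mono hKU) (by rintro _ ⟨t, ht, rfl⟩; exact h0 t ht)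
  obtain ⟨C, hC⟩ := (isCompact_graphOn hc).exists_bound_of_continuousOn hcont
  have hC' : ∀ t ∈ Icc a b, |M.eps2 f t (u t)| ≤ C := fun t ht => hC _ (mem_graphOn ht)
  refine ⟨max C (|M.ratio| * C), fun t ht => (hC' t ht).trans (le_max_left _ _),
    fun t ht => le_trans ?_ (le_max_right _ _)⟩
  rw [Method.eps3, abs_mul]
  exact mul_le_mul_of_nonneg_left (hC' t ht) (abs_nonneg _)

/-- Only the ratio matters, so the coupling persists even where the denominator vanishes. -/
theorem Method.shapeCondition
    (h : M.A.b2 * M.A.c2 ^ 2 + M.A.b3 * M.A.c3 ^ 2 * M.ratio = 0) (t v : ℝ) :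
    M.A.ShapeCondition (M.eps2 f t v) (M.eps3 f t v) := by
  unfold Tableau.ShapeCondition Method.eps3
  linear_combination M.eps2 f t v * h

theorem Method.eps2_mul_den {t v : ℝ} (h : M.den f t v ≠ 0) :
    M.eps2 f t v * M.den f t v = M.num f t v := div_mul_cancel₀ _ h

/-- In `hdef` the quotient is replaced by a free `e` with `e * den = num`, leaving a polynomial
identity without division. -/
theorem Method.fourthOrderMQ (hU : IsOpen U) (hf : SmoothOn U f)
    (hgraph : ∀ t ∈ Icc a b, (t, u t) ∈ U)
    (hu : ∀ t ∈ Icc a b, HasDerivWithinAt u (f t (u t)) (Icc a b) t)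
    (hA : M.A.ThirdOrderConditions)
    (hsh : M.A.b2 * M.A.c2 ^ 2 + M.A.b3 * M.A.c3 ^ 2 * M.ratio = 0)
    (hnum : SmoothOn U (M.num f)) (hden : SmoothOn U (M.den f))
    (hdef : ∀ e t v, e * M.den f t v = M.num f t v → defect M.A 1 f e (M.ratio * e) t v = 0) :
    M.FourthOrderMQ f a b u := by
  refine ⟨hA, Method.shapeCondition hsh, fun h0 => .of_isBigO ?_⟩
  obtain ⟨C, h2, h3⟩ := Method.exists_eps_bound (fun t ht => (hu t ht).continuousWithinAt)
    hgraph hnum hden h0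
  have H := hasExpansion_mqTruncation hU hf hgraph hu hA h2 h3
    fun t _ => Method.shapeCondition hsh t (u t)
  refine (H.congr (.of_forall fun _ => rfl) (.of_forall fun _ => rfl) (.of_forall fun _ => rfl)
    (.of_forall fun _ => rfl) (eventually_mem_Icc.mono fun p hp => ?_)).isBigO_pow_four
  exact (hdef _ _ _ (Method.eps2_mul_den (h0 _ hp))).symm

theorem Method.fourthOrderIMQ (hU : IsOpen U) (hf : SmoothOn U f)
    (hgraph : ∀ t ∈ Icc a b, (t, u t) ∈ U)
    (hu : ∀ t ∈ Icc a b, HasDerivWithinAt u (f t (u t)) (Icc a b) t)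
    (hA : M.A.ThirdOrderConditions)
    (hsh : M.A.b2 * M.A.c2 ^ 2 + M.A.b3 * M.A.c3 ^ 2 * M.ratio = 0)
    (hnum : SmoothOn U (M.num f)) (hden : SmoothOn U (M.den f))
    (hdef : ∀ e t v, e * M.den f t v = M.num f t v → defect M.A (-1) f e (M.ratio * e) t v = 0) :
    M.FourthOrderIMQ f a b u := by
  refine ⟨hA, Method.shapeCondition hsh, fun h0 => .of_isBigO ?_⟩
  obtain ⟨C, h2, h3⟩ := Method.exists_eps_bound (fun t ht => (hu t ht).continuousWithinAt)
    hgraph hnum hden h0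
  have H := hasExpansion_imqTruncation hU hf hgraph hu hA h2 h3
    fun t _ => Method.shapeCondition hsh t (u t)
  refine (H.congr (.of_forall fun _ => rfl) (.of_forall fun _ => rfl) (.of_forall fun _ => rfl)
    (.of_forall fun _ => rfl) (eventually_mem_Icc.mono fun p hp => ?_)).isBigO_pow_four
  exact (hdef _ _ _ (Method.eps2_mul_den (h0 _ hp))).symm

/-! ### The four tableaux and the seven methods -/

theorem thirdOrderConditions_tableauA : tableauA.ThirdOrderConditions := by
  constructor <;> norm_num [tableauA]

theorem thirdOrderConditions_tableauB : tableauB.ThirdOrderConditions := by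
  constructor <;> norm_num [tableauB]

theorem thirdOrderConditions_tableauC : tableauC.ThirdOrderConditions := by
  constructor <;> norm_num [tableauC]

theorem thirdOrderConditions_tableauD : tableauD.ThirdOrderConditions := by
  constructor <;> norm_num [tableauD]

/-- All expressions occurring in the shape parameters are polynomials in the following smooth
functions. -/
theorem smoothOn_partials (hU : IsOpen U) (hf : SmoothOn U f) :
    SmoothOn U (pt f) ∧ SmoothOn U (pu f) ∧ SmoothOn U (pt (pt f)) ∧ SmoothOn U (pt (pu f)) ∧
      SmoothOn U (pu (pu f)) ∧ SmoothOn U (pt (pt (pt f))) ∧ SmoothOn U (pt (pt (pu f))) ∧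
      SmoothOn U (pt (pu (pu f))) ∧ SmoothOn U (pu (pu (pu f))) :=
  ⟨hf.pt hU, hf.pu hU, (hf.pt hU).pt hU, (hf.pu hU).pt hU, (hf.pu hU).pu hU,
    ((hf.pt hU).pt hU).pt hU, ((hf.pu hU).pt hU).pt hU, ((hf.pu hU).pu hU).pt hU,
    ((hf.pu hU).pu hU).pu hU⟩

theorem mqI_fourthOrder (hU : IsOpen U) (hf : SmoothOn U f)
    (hgraph : ∀ t ∈ Icc a b, (t, u t) ∈ U)
    (hu : ∀ t ∈ Icc a b, HasDerivWithinAt u (f t (u t)) (Icc a b) t) :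
    mqI.FourthOrderMQ f a b u := by
  -- The anonymous facts stay in context for `fun_prop`.
  obtain ⟨_, _, _, _, _, _, _, _, _⟩ := smoothOn_partials hU hf
  refine Method.fourthOrderMQ hU hf hgraph hu thirdOrderConditions_tableauA
    (by norm_num [mqI, tableauA]) ?_ ?_ fun e t v he => ?_
  · simp only [mqI, SmoothOn] at *
    fun_prop
  · simp only [mqI, SmoothOn] at *
    fun_prop
  · simp only [mqI, tableauA, defect, stageTwo, stageThree, solD4, solD3, solD2] at he ⊢
    -- The defect is this constant times `e * den - num`. Comparing coefficients of `e v f f_uu`,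
    -- here and in the other six methods, the constant is `-σ/2 * (b₂c₂³ + b₃c₃³ * ratio)`.
    linear_combination (1 / 72) * he

theorem mqII_fourthOrder (hU : IsOpen U) (hf : SmoothOn U f)
    (hgraph : ∀ t ∈ Icc a b, (t, u t) ∈ U)
    (hu : ∀ t ∈ Icc a b, HasDerivWithinAt u (f t (u t)) (Icc a b) t) :
    mqII.FourthOrderMQ f a b u := by
  obtain ⟨_, _, _, _, _, _, _, _, _⟩ := smoothOn_partials hU hf
  refine Method.fourthOrderMQ hU hf hgraph hu thirdOrderConditions_tableauB
    (by norm_num [mqII, tableauB]) ?_ ?_ fun e t v he => ?_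
  · simp only [mqII, SmoothOn] at *
    fun_prop
  · simp only [mqII, SmoothOn] at *
    fun_prop
  · simp only [mqII, tableauB, defect, stageTwo, stageThree, solD4, solD3, solD2] at he ⊢
    linear_combination (-1 / 24) * he

theorem mqIII_fourthOrder (hU : IsOpen U) (hf : SmoothOn U f)
    (hgraph : ∀ t ∈ Icc a b, (t, u t) ∈ U)
    (hu : ∀ t ∈ Icc a b, HasDerivWithinAt u (f t (u t)) (Icc a b) t) :
    mqIII.FourthOrderMQ f a b u := by
  obtain ⟨_, _, _, _, _, _, _, _, _⟩ := smoothOn_partials hU hf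
  refine Method.fourthOrderMQ hU hf hgraph hu thirdOrderConditions_tableauC
    (by norm_num [mqIII, tableauC]) ?_ ?_ fun e t v he => ?_
  · simp only [mqIII, SmoothOn] at *
    fun_prop
  · simp only [mqIII, SmoothOn] at *
    fun_prop
  · simp only [mqIII, tableauC, defect, stageTwo, stageThree, solD4, solD3, solD2] at he ⊢
    linear_combination (1 / 96) * he

theorem imqI_fourthOrder (hU : IsOpen U) (hf : SmoothOn U f)
    (hgraph : ∀ t ∈ Icc a b, (t, u t) ∈ U)
    (hu : ∀ t ∈ Icc a b, HasDerivWithinAt u (f t (u t)) (Icc a b) t) :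
    imqI.FourthOrderIMQ f a b u := by
  obtain ⟨_, _, _, _, _, _, _, _, _⟩ := smoothOn_partials hU hf
  refine Method.fourthOrderIMQ hU hf hgraph hu thirdOrderConditions_tableauD
    (by norm_num [imqI, tableauD]) ?_ ?_ fun e t v he => ?_
  · simp only [imqI, SmoothOn] at *
    fun_prop
  · simp only [imqI, SmoothOn] at *
    fun_prop
  · simp only [imqI, tableauD, defect, stageTwo, stageThree, solD4, solD3, solD2] at he ⊢
    linear_combination (-1 / 24) * he

theorem imqII_fourthOrder (hU : IsOpen U) (hf : SmoothOn U f)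
    (hgraph : ∀ t ∈ Icc a b, (t, u t) ∈ U)
    (hu : ∀ t ∈ Icc a b, HasDerivWithinAt u (f t (u t)) (Icc a b) t) :
    imqII.FourthOrderIMQ f a b u := by
  obtain ⟨_, _, _, _, _, _, _, _, _⟩ := smoothOn_partials hU hf
  refine Method.fourthOrderIMQ hU hf hgraph hu thirdOrderConditions_tableauA
    (by norm_num [imqII, tableauA]) ?_ ?_ fun e t v he => ?_
  · simp only [imqII, SmoothOn] at *
    fun_prop
  · simp only [imqII, SmoothOn] at *
    fun_prop
  · simp only [imqII, tableauA, defect, stageTwo, stageThree, solD4, solD3, solD2] at he ⊢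
    linear_combination (-1 / 72) * he

theorem imqIII_fourthOrder (hU : IsOpen U) (hf : SmoothOn U f)
    (hgraph : ∀ t ∈ Icc a b, (t, u t) ∈ U)
    (hu : ∀ t ∈ Icc a b, HasDerivWithinAt u (f t (u t)) (Icc a b) t) :
    imqIII.FourthOrderIMQ f a b u := by
  obtain ⟨_, _, _, _, _, _, _, _, _⟩ := smoothOn_partials hU hf
  refine Method.fourthOrderIMQ hU hf hgraph hu thirdOrderConditions_tableauB
    (by norm_num [imqIII, tableauB]) ?_ ?_ fun e t v he => ?_
  · simp only [imqIII, SmoothOn] at *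
    fun_prop
  · simp only [imqIII, SmoothOn] at *
    fun_prop
  · simp only [imqIII, tableauB, defect, stageTwo, stageThree, solD4, solD3, solD2] at he ⊢
    linear_combination (1 / 24) * he

theorem imqIV_fourthOrder (hU : IsOpen U) (hf : SmoothOn U f)
    (hgraph : ∀ t ∈ Icc a b, (t, u t) ∈ U)
    (hu : ∀ t ∈ Icc a b, HasDerivWithinAt u (f t (u t)) (Icc a b) t) :
    imqIV.FourthOrderIMQ f a b u := by
  obtain ⟨_, _, _, _, _, _, _, _, _⟩ := smoothOn_partials hU hf
  refine Method.fourthOrderIMQ hU hf hgraph hu thirdOrderConditions_tableauC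
    (by norm_num [imqIV, tableauC]) ?_ ?_ fun e t v he => ?_
  · simp only [imqIV, SmoothOn] at *
    fun_prop
  · simp only [imqIV, SmoothOn] at *
    fun_prop
  · simp only [imqIV, tableauC, defect, stageTwo, stageThree, solD4, solD3, solD2] at he ⊢
    linear_combination (-1 / 96) * he

end Methods

end RBFRK

end

theorem mainTheorem6
    (f : ℝ → ℝ → ℝ) (U : Set (ℝ × ℝ)) (hU : IsOpen U)
    (hf : ContDiffOn ℝ ∞ (fun p : ℝ × ℝ => f p.1 p.2) U)
    (a b : ℝ) (hab : a < b) (u : ℝ → ℝ)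
    (hgraph : ∀ t ∈ Set.Icc a b, (t, u t) ∈ U)
    (hu : ∀ t ∈ Set.Icc a b, HasDerivWithinAt u (f t (u t)) (Set.Icc a b) t) :
    (∀ (A : RBFRK.Tableau) (e2 e3 : ℝ → ℝ → ℝ),
      A.ThirdOrderConditions →
      (∃ K : ℝ, ∀ t ∈ Set.Icc a b, |e2 t (u t)| ≤ K ∧ |e3 t (u t)| ≤ K) →
      (∀ t ∈ Set.Icc a b, A.ShapeCondition (e2 t (u t)) (e3 t (u t))) →
      RBFRK.OrderOn a b 3 (RBFRK.mqTruncation A f e2 e3 u) ∧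
      RBFRK.OrderOn a b 3 (RBFRK.imqTruncation A f e2 e3 u)) ∧
    (RBFRK.mqI.FourthOrderMQ f a b u ∧
      RBFRK.mqII.FourthOrderMQ f a b u ∧
      RBFRK.mqIII.FourthOrderMQ f a b u) ∧
    (RBFRK.imqI.FourthOrderIMQ f a b u ∧
      RBFRK.imqII.FourthOrderIMQ f a b u ∧
      RBFRK.imqIII.FourthOrderIMQ f a b u ∧
      RBFRK.imqIV.FourthOrderIMQ f a b u) := by
  have hs : RBFRK.SmoothOn U f := hf
  refine ⟨fun A e2 e3 hA ⟨K, hK⟩ hsh => ⟨?_, ?_⟩,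
    ⟨RBFRK.mqI_fourthOrder hU hs hgraph hu, RBFRK.mqII_fourthOrder hU hs hgraph hu,
      RBFRK.mqIII_fourthOrder hU hs hgraph hu⟩,
    RBFRK.imqI_fourthOrder hU hs hgraph hu, RBFRK.imqII_fourthOrder hU hs hgraph hu,
    RBFRK.imqIII_fourthOrder hU hs hgraph hu, RBFRK.imqIV_fourthOrder hU hs hgraph hu⟩
  · exact .of_isBigO ((RBFRK.hasExpansion_mqTruncation hU hs hgraph hu hA
      (fun t ht => (hK t ht).1) (fun t ht => (hK t ht).2) hsh).isBigO_pow_three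
      (RBFRK.tendsto_step.isBigO_one ℝ))
  · exact .of_isBigO ((RBFRK.hasExpansion_imqTruncation hU hs hgraph hu hA
      (fun t ht => (hK t ht).1) (fun t ht => (hK t ht).2) hsh).isBigO_pow_three
      (RBFRK.tendsto_step.isBigO_one ℝ))
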